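/- **Setting.** Let $\Omega\subset\mathbb R^d$ be compact and contained in an open set $\overline\Omega\subseteq\mathbb R^d$, let $f_1,\dots,f_\kappa:\overline\Omega\to\mathbb R$ be real-analytic, let $\mathbf A_1,\dots,\mathbf A_\kappa$ be compact self-adjoint operators on $\ell^2(\mathbb N)$, and put $\mathbf A(\omega)=\sum_{\ell=1}^{\kappa}f_\ell(\omega)\mathbf A_\ell$. Fix $J\ge 1$ and assume that $\mathbf A(\omega)$ has at least $J$ positive eigenvalues, counted with multiplicity, for every $\omega\in\Omega$. Let $\lambda_j(\omega)$ denote the $j$th largest eigenvalue of $\mathbf A(\omega)$, counted with multiplicity. For a finite dimensional subspace $\mathcal V$ of $\ell^2(\mathbb N)$ and the isometry $\mathbf V:\mathbb C^m\to\ell^2(\mathbb N)$, $\mathbf V\alpha=\sum_j\alpha_jv_j$, given by an orthonormal basis $v_1,\dots,v_m$ of $\mathcal V$, let $\lambda_J^{\mathcal V}(\omega)$ be the $J$th largest eigenvalue of $\mathbf V^*\mathbf A(\omega)\mathbf V$. **Greedy procedure (Algorithm 1).** Choose $\omega^{(1)}\in\Omega$ and let $\mathcal S_1$ be the span of $J$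 linearly independent eigenvectors of $\mathbf A(\omega^{(1)})$ for $\lambda_1(\omega^{(1)}),\dots,\lambda_J(\omega^{(1)})$. For $k=2,3,\dots$ let $\omega^{(k)}$ be any global minimizer over $\Omega$ of $\lambda_J^{(k-1)}:=\lambda_J^{\mathcal S_{k-1}}$ (for every $k$, minimization problem), or any global maximizer (for every $k$, maximization problem), and let $\mathcal S_k$ be the sum of $\mathcal S_{k-1}$ and the span of $J$ linearly independent eigenvectors of $\mathbf A(\omega^{(k)})$ for $\lambda_1(\omega^{(k)}),\dots,\lambda_J(\omega^{(k)})$. Put $h^{(k)}:=\|\omega^{(k)}-\omega^{(k-1)}\|_2$ for $k\ge2$. **Extended greedy procedure (Algorithm 2).** The same, except that for $k\ge 2$ one also adds to $\mathcal S_k$, for all $1\le p\le q\le d$, the span of $J$ linearly independent eigenvectors of $\mathbf A(\omega^{(k)}+h^{(k)}e_{pq})$ for its $J$ largest eigenvalues (these points being in $\overline\Omega$), where $e_{pp}=e_p$ and $e_{pq}=(e_p+e_q)/\sqrt2$ for $p\ne q$. **Lemma.** Suppose that the sequence $\{\omega^{(k)}\}$ produced by Algorithm 2 (or by Algorithm 1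 when $d=1$) converges to a point $\omega_*$ in the interior of $\Omega$, and that the eigenvalue $\lambda_J(\omega_*)$ is simple. Assume furthermore that in an open ball containing $\omega_*$ all third derivatives of the functions $\omega\mapsto\lambda_J^{(k)}(\omega)$ exist and are bounded uniformly with respect to $k\ge k_0$, with $k_0$ sufficiently large. Then $\lambda_J$ and $\lambda_J^{(k)}$ are twice continuously differentiable at $\omega^{(k)}$ for all large $k$, and the following hold. (i) There is a constant $C>0$ such that, for all large enough $k$ with $h^{(k)}>0$, $$\left|\frac{\partial^2\lambda_J(\omega^{(k)})}{\partial\omega_p\,\partial\omega_q}-\frac{\partial^2\lambda_J^{(k)}(\omega^{(k)})}{\partial\omega_p\,\partial\omega_q}\right|\le C\,h^{(k)}\quad\text{for } p,q=1,\dots,d,$$ in particular $$\left\|\nabla^2\lambda_J(\omega^{(k)})-\nabla^2\lambda_J^{(k)}(\omega^{(k)})\right\|_2\le d\,C\,h^{(k)}.$$ (ii) If, in addition, $\nabla^2\lambda_J(\omega_*)$ is invertible, then $\nabla^2\lambda_J(\omega^{(k)})$ is invertible for all large enough $k$, and there is a constant $C'>0$ such that, for all large enough $k$ with $h^{(k)}>0$,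 $\nabla^2\lambda_J^{(k)}(\omega^{(k)})$ is invertible and $$\left\|\left[\nabla^2\lambda_J(\omega^{(k)})\right]^{-1}-\left[\nabla^2\lambda_J^{(k)}(\omega^{(k)})\right]^{-1}\right\|_2\le C'\,h^{(k)}.$$ -/

import Mathlib

open Filter Topology

noncomputable section

/-- The space `ℓ²(ℕ)` of square summable complex sequences. -/
abbrev Ell2 : Type := lp (fun _ : ℕ => ℂ) 2

/-- The parameter space `ℝ^d` with the Euclidean norm. -/
abbrev Param (d : ℕ) : Type := EuclideanSpace ℝ (Fin d)

/-- The operator `𝐀(ω) = ∑_ℓ f_ℓ(ω) 𝐀_ℓ` on `ℓ²(ℕ)`. -/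
def opFun {d κ : ℕ} (f : Fin κ → Param d → ℝ) (A : Fin κ → Ell2 →L[ℂ] Ell2)
    (ω : Param d) : Ell2 →L[ℂ] Ell2 :=
  ∑ l, ((f l ω : ℝ) : ℂ) • A l

section Eigenvalues

variable {F : Type} [NormedAddCommGroup F] [InnerProductSpace ℂ F]

/-- The number of eigenvalues of the (self-adjoint) operator `T` that lie in the set `I` of reals,
counted with multiplicity: the dimension of the sum of the eigenspaces for eigenvalues in `I`. -/
def eigCount (T : F →L[ℂ] F) (I : Set ℝ) : Cardinal :=
  Module.rank ℂ (⨆ ν ∈ I, Module.End.eigenspace (T : F →ₗ[ℂ] F) (ν : ℂ) : Submodule ℂ F)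

/-- The `J`-th largest eigenvalue (`J ≥ 1`), counted with multiplicity, of the self-adjoint
operator `T`: the largest real `μ` such that at least `J` eigenvalues of `T` are `≥ μ`. -/
def eigval (J : ℕ) (T : F →L[ℂ] F) : ℝ :=
  sSup {μ : ℝ | (J : Cardinal) ≤ eigCount T (Set.Ici μ)}

/-- `s 0, …, s (J-1)` are (linearly independent) eigenvectors of `T` corresponding to its
`J` largest eigenvalues `λ₁, …, λ_J`, counted with multiplicity. -/
def IsTopEigenvectors {J : ℕ} (T : F →L[ℂ] F) (s : Fin J → F) : Prop :=
  LinearIndependent ℂ s ∧ ∀ j : Fin J, T (s j) = (eigval (j + 1) T : ℂ) • s j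

end Eigenvalues

/-- The reduced operator `𝐕* T 𝐕` on `ℂ^m`. Here `𝐕 : ℂ^m → ℓ²(ℕ)`, `𝐕 α = ∑ α_j v_j`, is the
isometry which is given by an orthonormal basis `v` of the subspace `range 𝐕`. -/
def redOp {m : ℕ} (V : EuclideanSpace ℂ (Fin m) →ₗᵢ[ℂ] Ell2) (T : Ell2 →L[ℂ] Ell2) :
    EuclideanSpace ℂ (Fin m) →L[ℂ] EuclideanSpace ℂ (Fin m) :=
  (ContinuousLinearMap.adjoint V.toContinuousLinearMap).comp (T.comp V.toContinuousLinearMap)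

/-- The eigenvalue function `λ_J(ω)` of the full problem. -/
def lam {d κ : ℕ} (f : Fin κ → Param d → ℝ) (A : Fin κ → Ell2 →L[ℂ] Ell2) (J : ℕ)
    (ω : Param d) : ℝ :=
  eigval J (opFun f A ω)

/-- The reduced eigenvalue function `λ_J^𝒱(ω)` for the subspace `𝒱 = range 𝐕`. -/
def redLam {d κ : ℕ} (f : Fin κ → Param d → ℝ) (A : Fin κ → Ell2 →L[ℂ] Ell2) (J : ℕ)
    {m : ℕ} (V : EuclideanSpace ℂ (Fin m) →ₗᵢ[ℂ] Ell2) (ω : Param d) : ℝ :=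
  eigval J (redOp V (opFun f A ω))

/-- The step length `h^(k) = ‖ω^(k) - ω^(k-1)‖₂` (meaningful for `k ≥ 2`). -/
def stepLen {d : ℕ} (ω : ℕ → Param d) (k : ℕ) : ℝ := ‖ω k - ω (k - 1)‖

/-- The `p`-th standard unit vector of `ℝ^d`. -/
def unitVec {d : ℕ} (p : Fin d) : Param d := EuclideanSpace.single p (1 : ℝ)

/-- The unit vectors `e_pp = e_p` and `e_pq = (e_p + e_q) / √2` for `p ≠ q`. -/
def dirVec {d : ℕ} (p q : Fin d) : Param d :=
  if p = q then unitVec p else (1 / Real.sqrt 2) • (unitVec p + unitVec q)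

/-- The iterates `ω^(k)`, `k ≥ 1`, lie in `Ω`, and each `ω^(k)` with `k ≥ 2` is a global minimizer
(for every `k`, in the minimization problem), or a global maximizer (for every `k`, in the
maximization problem), over `Ω` of the reduced eigenvalue function `λ_J^(k-1)` which belongs to the
subspace `𝒮_{k-1} = range (V (k-1))`. -/
def IsIterates {d κ : ℕ} (f : Fin κ → Param d → ℝ) (A : Fin κ → Ell2 →L[ℂ] Ell2) (Ω : Set (Param d))
    (J : ℕ) (ω : ℕ → Param d) (m : ℕ → ℕ)
    (V : (k : ℕ) → EuclideanSpace ℂ (Fin (m k)) →ₗᵢ[ℂ] Ell2) : Prop :=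
  (∀ k, 1 ≤ k → ω k ∈ Ω) ∧
  ((∀ k, 2 ≤ k → IsMinOn (redLam f A J (V (k - 1))) Ω (ω k)) ∨
   (∀ k, 2 ≤ k → IsMaxOn (redLam f A J (V (k - 1))) Ω (ω k)))

/-- `ω` (indexed from `1`) is a sequence produced by the greedy subspace procedure, and `V k` is
the isometry of an orthonormal basis of the `k`-th subspace `𝒮_k`; the values at `k = 0` play
no role. -/
def IsGreedyRun {d κ : ℕ} (f : Fin κ → Param d → ℝ) (A : Fin κ → Ell2 →L[ℂ] Ell2)
    (Ω : Set (Param d)) (J : ℕ) (ω : ℕ → Param d) (m : ℕ → ℕ)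
    (V : (k : ℕ) → EuclideanSpace ℂ (Fin (m k)) →ₗᵢ[ℂ] Ell2) : Prop :=
  IsIterates f A Ω J ω m V ∧
  ∃ s : ℕ → Fin J → Ell2,
    (∀ k, 1 ≤ k → IsTopEigenvectors (opFun f A (ω k)) (s k)) ∧
    LinearMap.range (V 1).toLinearMap = Submodule.span ℂ (Set.range (s 1)) ∧
    ∀ k, 2 ≤ k → LinearMap.range (V k).toLinearMap =
      LinearMap.range (V (k - 1)).toLinearMap ⊔ Submodule.span ℂ (Set.range (s k))

/-- `ω` (indexed from `1`) is a sequence produced by the extended greedy subspace procedure, and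
`V k` is the isometry of an orthonormal basis of the `k`-th subspace `𝒮_k`; the values at `k = 0`
play no role. The additional points `ω^(k) + h^(k) e_pq` lie in the open set `D` on which
`𝐀` is defined, as the procedure needs eigenvectors of `𝐀` there. -/
def IsExtGreedyRun {d κ : ℕ} (f : Fin κ → Param d → ℝ) (A : Fin κ → Ell2 →L[ℂ] Ell2)
    (D Ω : Set (Param d)) (J : ℕ) (ω : ℕ → Param d) (m : ℕ → ℕ)
    (V : (k : ℕ) → EuclideanSpace ℂ (Fin (m k)) →ₗᵢ[ℂ] Ell2) : Prop :=
  IsIterates f A Ω J ω m V ∧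
  ∃ (s : ℕ → Fin J → Ell2) (t : ℕ → Fin d → Fin d → Fin J → Ell2),
    (∀ k, 1 ≤ k → IsTopEigenvectors (opFun f A (ω k)) (s k)) ∧
    (∀ k, 2 ≤ k → ∀ p q : Fin d, p ≤ q →
      ω k + stepLen ω k • dirVec p q ∈ D ∧
      IsTopEigenvectors (opFun f A (ω k + stepLen ω k • dirVec p q)) (t k p q)) ∧
    LinearMap.range (V 1).toLinearMap = Submodule.span ℂ (Set.range (s 1)) ∧
    ∀ k, 2 ≤ k → LinearMap.range (V k).toLinearMap =
      LinearMap.range (V (k - 1)).toLinearMap ⊔ Submodule.span ℂ (Set.range (s k)) ⊔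
        ⨆ (p : Fin d) (q : Fin d) (_ : p ≤ q), Submodule.span ℂ (Set.range (t k p q))

/-- The Hessian matrix `∇² g(ω)`, with entries `∂² g(ω) / ∂ω_p ∂ω_q`. -/
def hessian {d : ℕ} (g : Param d → ℝ) (ω : Param d) : Matrix (Fin d) (Fin d) ℝ :=
  Matrix.of fun p q => iteratedFDeriv ℝ 2 g ω ![unitVec p, unitVec q]

/-- The spectral norm (operator norm for the Euclidean norm) of a real square matrix. -/
def specNorm {d : ℕ} (M : Matrix (Fin d) (Fin d) ℝ) : ℝ :=
  ‖Matrix.toEuclideanCLM (n := Fin d) (𝕜 := ℝ) M‖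

/-- In some open ball containing `ωs`, all `g k` with `k` large are three times differentiable and
their third partial derivatives are bounded by a constant that does not depend on `k`. -/
def UniformlyBoundedThirdDerivs {d : ℕ} (g : ℕ → Param d → ℝ) (ωs : Param d) : Prop :=
  ∃ (c : Param d) (r M : ℝ) (k₀ : ℕ), ωs ∈ Metric.ball c r ∧ ∀ k, k₀ ≤ k →
    (∀ i < 3, DifferentiableOn ℝ (iteratedFDeriv ℝ i (g k)) (Metric.ball c r)) ∧
    ∀ ω ∈ Metric.ball c r, ∀ p q l : Fin d,
      |iteratedFDeriv ℝ 3 (g k) ω ![unitVec p, unitVec q, unitVec l]| ≤ M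

end

/-! Put `φ = λ_J - λ_J^(k)`. By minimax `φ ≥ 0` on `Ω`, and `φ` vanishes wherever the subspace
contains the top `J` eigenvectors. So `φ` vanishes at `ω^(k)`, where its gradient vanishes too
because this is a local minimum. It also vanishes at distance `h = h^(k)` along each `e_pq`: at the
added points in the extended procedure, or at `ω^(k-1)`, up to sign of the direction, when `d = 1`.

On the line through `ω^(k)` in such a direction, `φ(0) = φ'(0) = φ(h) = 0`. Rolle's theorem used
twice gives a zero of `φ''` in `(0, h)`, and the mean value theorem then gives `|φ''(0)| ≤ h sup
|φ'''|`. Polarization recovers the mixed derivatives, and local Lipschitz continuity of matrix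
inversion gives (ii).

The third derivatives of `λ_J^(k)` are bounded by assumption; those of `λ_J` are bounded near `ω_*`
since a simple positive eigenvalue depends smoothly on the parameter
(`contDiffAt_eigval_of_simple`). That is the implicit function theorem applied to a bordered
resolvent. The spectral input is one half of minimax, `le_eigCount_Ici_of_form`; it yields
attainment of `eigval`, Weyl's inequality and `eigval_redOp_le`. The analytic core is
`abs_iteratedFDeriv_two_sub_le`. -/

open scoped InnerProductSpace

/-! ### Spectral subspaces and elementary properties of `eigval` -/

section SpectralSubspace

variable {F : Type} [NormedAddCommGroup F] [InnerProductSpace ℂ F]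

/-- The sum of the eigenspaces of `T` for eigenvalues in `I`. -/
def eigSum (T : F →L[ℂ] F) (I : Set ℝ) : Submodule ℂ F :=
  ⨆ ν ∈ I, Module.End.eigenspace (T : F →ₗ[ℂ] F) (ν : ℂ)

theorem eigCount_eq_rank_eigSum (T : F →L[ℂ] F) (I : Set ℝ) :
    eigCount T I = Module.rank ℂ (eigSum T I) := rfl

theorem eigSum_mono (T : F →L[ℂ] F) {I I' : Set ℝ} (h : I ⊆ I') : eigSum T I ≤ eigSum T I' :=
  biSup_mono h

theorem eigCount_mono (T : F →L[ℂ] F) {I I' : Set ℝ} (h : I ⊆ I') :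
    eigCount T I ≤ eigCount T I' :=
  Submodule.rank_mono (eigSum_mono T h)

theorem mem_eigSum_of_apply_eq {T : F →L[ℂ] F} {I : Set ℝ} {ν : ℝ} (hν : ν ∈ I) {x : F}
    (hx : T x = (ν : ℂ) • x) : x ∈ eigSum T I :=
  (le_biSup (fun ν : ℝ => Module.End.eigenspace (T : F →ₗ[ℂ] F) (ν : ℂ)) hν)
    (Module.End.mem_eigenspace_iff.2 hx)

theorem apply_mem_eigSum {T : F →L[ℂ] F} {I : Set ℝ} {x : F} (hx : x ∈ eigSum T I) :
    T x ∈ eigSum T I := by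
  have h : eigSum T I ≤ (eigSum T I).comap (T : F →ₗ[ℂ] F) := by
    refine iSup₂_le fun ν hν y hy => ?_
    have hy' : T y = (ν : ℂ) • y := Module.End.mem_eigenspace_iff.1 hy
    change T y ∈ eigSum T I
    rw [hy']
    exact Submodule.smul_mem _ _ (mem_eigSum_of_apply_eq hν hy')
  exact h hx

theorem eigenvalue_le_norm {T : F →L[ℂ] F} {ν : ℝ} {x : F} (hx : x ≠ 0)
    (h : T x = (ν : ℂ) • x) : ν ≤ ‖T‖ := by
  have h1 := T.le_opNorm x
  rw [h, norm_smul] at h1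
  have h2 := le_of_mul_le_mul_right h1 (norm_pos_iff.2 hx)
  exact (le_abs_self ν).trans (by simpa using h2)

theorem eigSum_Ici_eq_bot {T : F →L[ℂ] F} {μ : ℝ} (h : ‖T‖ < μ) : eigSum T (Set.Ici μ) = ⊥ := by
  refine iSup₂_eq_bot.2 fun ν hν => (Submodule.eq_bot_iff _).2 fun x hx => ?_
  by_contra hx0
  exact absurd (eigenvalue_le_norm hx0 (Module.End.mem_eigenspace_iff.1 hx))
    (not_le.2 (h.trans_le hν))

theorem bddAbove_eigCount_Ici (T : F →L[ℂ] F) {J : ℕ} (hJ : 1 ≤ J) :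
    BddAbove {μ : ℝ | (J : Cardinal) ≤ eigCount T (Set.Ici μ)} := by
  refine ⟨‖T‖, fun μ hμ => ?_⟩
  by_contra! h
  have hμ' : (J : Cardinal) ≤ eigCount T (Set.Ici μ) := hμ
  rw [eigCount_eq_rank_eigSum, eigSum_Ici_eq_bot h, rank_bot] at hμ'
  have : J ≤ 0 := by exact_mod_cast hμ'
  omega

theorem le_eigval {T : F →L[ℂ] F} {J : ℕ} (hJ : 1 ≤ J) {μ : ℝ}
    (h : (J : Cardinal) ≤ eigCount T (Set.Ici μ)) : μ ≤ eigval J T :=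
  le_csSup (bddAbove_eigCount_Ici T hJ) h

theorem le_eigCount_Ici_of_lt_eigval {T : F →L[ℂ] F} {J : ℕ} {μ : ℝ}
    (hne : ∃ μ : ℝ, (J : Cardinal) ≤ eigCount T (Set.Ici μ)) (h : μ < eigval J T) :
    (J : Cardinal) ≤ eigCount T (Set.Ici μ) := by
  obtain ⟨ν, hν, hlt⟩ := exists_lt_of_lt_csSup hne h
  exact le_trans hν (eigCount_mono T (Set.Ici_subset_Ici.2 hlt.le))

theorem eigval_antitone {T : F →L[ℂ] F} {J J' : ℕ} (hJ' : 1 ≤ J') (hle : J' ≤ J)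
    (hne : ∃ μ : ℝ, (J : Cardinal) ≤ eigCount T (Set.Ici μ)) : eigval J T ≤ eigval J' T :=
  csSup_le_csSup (bddAbove_eigCount_Ici T hJ') hne
    fun μ hμ => (le_trans (Nat.cast_le.2 hle) hμ : (J' : Cardinal) ≤ eigCount T (Set.Ici μ))

/-- Finitely many independent vectors of an increasing union of spectral subspaces lie in one of
them. -/
theorem exists_le_eigCount_Ici_of_Ioi {T : F →L[ℂ] F} {J : ℕ} {a : ℝ}
    (h : (J : Cardinal) ≤ eigCount T (Set.Ioi a)) :
    ∃ μ, a < μ ∧ (J : Cardinal) ≤ eigCount T (Set.Ici μ) := by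
  obtain ⟨v, hv⟩ := Module.le_rank_iff.1 h
  have hmem : ∀ j, ∃ μ : ℝ, a < μ ∧ (v j : F) ∈ eigSum T (Set.Ici μ) := by
    intro j
    have hle : eigSum T (Set.Ioi a) ≤ ⨆ μ : Set.Ioi a, eigSum T (Set.Ici (μ : ℝ)) :=
      iSup₂_le fun ν hν y hy => Submodule.mem_iSup_of_mem ⟨ν, hν⟩
        (mem_eigSum_of_apply_eq (Set.self_mem_Ici) (Module.End.mem_eigenspace_iff.1 hy))
    have : Nonempty (Set.Ioi a) := ⟨⟨a + 1, by simp⟩⟩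
    have hdir : Directed (· ≤ ·) fun μ : Set.Ioi a => eigSum T (Set.Ici (μ : ℝ)) := by
      intro μ ν
      refine ⟨⟨min μ ν, Set.mem_Ioi.2 (lt_min μ.2 ν.2)⟩, eigSum_mono T ?_, eigSum_mono T ?_⟩
      · exact Set.Ici_subset_Ici.2 (min_le_left _ _)
      · exact Set.Ici_subset_Ici.2 (min_le_right _ _)
    obtain ⟨μ, hμ⟩ := (Submodule.mem_iSup_of_directed _ hdir).1 (hle (v j).2)
    exact ⟨μ, μ.2, hμ⟩
  choose μ hμ hvμ using hmem
  obtain ⟨μ₀, hμ₀, hle⟩ : ∃ μ₀, a < μ₀ ∧ ∀ j, μ₀ ≤ μ j := by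
    rcases isEmpty_or_nonempty (Fin J) with hE | hE
    -- For `J = 0` there is no minimum to take, and any number above `a` serves.
    · exact ⟨a + 1, by simp, fun j => (hE.false j).elim⟩
    · obtain ⟨j₀, hj₀⟩ := Finite.exists_min μ
      exact ⟨μ j₀, hμ j₀, hj₀⟩
  refine ⟨μ₀, hμ₀, Module.le_rank_iff.2
    ⟨fun j => ⟨v j, eigSum_mono T (Set.Ici_subset_Ici.2 (hle j)) (hvμ j)⟩, ?_⟩⟩
  have h1 : LinearIndependent ℂ fun j => (v j : F) :=
    hv.map' (Submodule.subtype _) (Submodule.ker_subtype _)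
  exact LinearIndependent.of_comp (Submodule.subtype _) h1

/-- The quadratic form of a symmetric operator is bounded below on spectral subspaces. -/
theorem le_re_inner_of_mem_eigSum {T : F →L[ℂ] F} (hT : (T : F →ₗ[ℂ] F).IsSymmetric) {μ : ℝ}
    {x : F} (hx : x ∈ eigSum T (Set.Ici μ)) : μ * ‖x‖ ^ 2 ≤ (⟪T x, x⟫_ℂ).re := by
  have h' : x ∈ ⨆ ν : Set.Ici μ, Module.End.eigenspace (T : F →ₗ[ℂ] F) ((ν : ℝ) : ℂ) := by
    rw [iSup_subtype]; exact hx
  have horth : OrthogonalFamily ℂ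
      (fun ν : Set.Ici μ => Module.End.eigenspace (T : F →ₗ[ℂ] F) ((ν : ℝ) : ℂ))
      fun ν => (Module.End.eigenspace (T : F →ₗ[ℂ] F) ((ν : ℝ) : ℂ)).subtypeₗᵢ :=
    hT.orthogonalFamily_eigenspaces.comp (f := fun ν : Set.Ici μ => ((ν : ℝ) : ℂ))
      (Complex.ofReal_injective.comp Subtype.val_injective)
  obtain ⟨f, hf⟩ := (Submodule.mem_iSup_iff_exists_finsupp _ _).1 h'
  obtain ⟨hfm, rfl⟩ := hf
  let g : (ν : Set.Ici μ) → Module.End.eigenspace (T : F →ₗ[ℂ] F) ((ν : ℝ) : ℂ) :=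
    fun ν => ⟨f ν, hfm ν⟩
  let g' : (ν : Set.Ici μ) → Module.End.eigenspace (T : F →ₗ[ℂ] F) ((ν : ℝ) : ℂ) :=
    fun ν => ((ν : ℝ) : ℂ) • g ν
  have hTf : ∀ ν, T (f ν) = ((ν : ℝ) : ℂ) • f ν := fun ν =>
    Module.End.mem_eigenspace_iff.1 (hfm ν)
  have e1 : (f.sum fun _ y => y) = ∑ ν ∈ f.support,
      (Module.End.eigenspace (T : F →ₗ[ℂ] F) ((ν : ℝ) : ℂ)).subtypeₗᵢ (g ν) := rfl
  have e2 : T (f.sum fun _ y => y) = ∑ ν ∈ f.support,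
      (Module.End.eigenspace (T : F →ₗ[ℂ] F) ((ν : ℝ) : ℂ)).subtypeₗᵢ (g' ν) := by
    rw [Finsupp.sum, map_sum]
    exact Finset.sum_congr rfl fun ν _ => hTf ν
  -- By orthogonality of the eigenspaces the form is `∑ ν ‖x_ν‖²`, with every `ν ≥ μ`.
  rw [e2, e1, horth.norm_sum, horth.inner_sum, Complex.re_sum, Finset.mul_sum]
  refine Finset.sum_le_sum fun ν _ => ?_
  have e3 : ⟪g' ν, g ν⟫_ℂ = ((ν : ℝ) : ℂ) * ⟪g ν, g ν⟫_ℂ := by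
    simp only [g', inner_smul_left, Complex.conj_ofReal]
  rw [e3, Complex.re_ofReal_mul, inner_self_eq_norm_sq_to_K]
  have : ((((‖g ν‖ : ℝ) : ℂ)) ^ 2).re = ‖g ν‖ ^ 2 := by
    rw [← Complex.ofReal_pow, Complex.ofReal_re]
  erw [this]
  exact mul_le_mul_of_nonneg_right ν.2 (sq_nonneg _)

theorem eigval_pos {T : F →L[ℂ] F} {J : ℕ} (hJ : 1 ≤ J)
    (h : (J : Cardinal) ≤ eigCount T (Set.Ioi 0)) : 0 < eigval J T := by
  obtain ⟨μ, hμ, hle⟩ := exists_le_eigCount_Ici_of_Ioi h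
  exact hμ.trans_le (le_eigval hJ hle)

end SpectralSubspace

/-! ### Minimax and Weyl's inequality for positive eigenvalues of compact operators -/

section Compact

/-- Functional calculus turns the bound on the spectrum into the operator inequality `S ≤ μ · 1`. -/
theorem re_inner_le_of_spectrum_le {H : Type} [NormedAddCommGroup H] [InnerProductSpace ℂ H]
    [CompleteSpace H] {S : H →L[ℂ] H} (hS : IsSelfAdjoint S) {μ : ℝ}
    (h : ∀ s ∈ spectrum ℝ S, s ≤ μ) (x : H) : (⟪S x, x⟫_ℂ).re ≤ μ * ‖x‖ ^ 2 := by
  have h1 : S ≤ algebraMap ℝ (H →L[ℂ] H) μ := le_algebraMap_of_spectrum_le h hS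
  have h2 := ((ContinuousLinearMap.le_def _ _).1 h1).re_inner_nonneg_left x
  have h3 : (algebraMap ℝ (H →L[ℂ] H) μ) x = (μ : ℂ) • x := rfl
  rw [sub_apply, inner_sub_left, h3, inner_smul_left, Complex.conj_ofReal,
    inner_self_eq_norm_sq_to_K, map_sub] at h2
  have h4 : RCLike.re ((μ : ℂ) * ((‖x‖ : ℝ) : ℂ) ^ 2) = μ * ‖x‖ ^ 2 := by
    rw [← Complex.ofReal_pow, ← Complex.ofReal_mul]; rfl
  erw [h4] at h2
  have h5 : RCLike.re ⟪S x, x⟫_ℂ = (⟪S x, x⟫_ℂ).re := rfl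
  linarith

variable {F : Type} [NormedAddCommGroup F] [InnerProductSpace ℂ F] [CompleteSpace F]

/-- On the orthogonal complement of the eigenspaces for eigenvalues `≥ lam₀ > 0`, the quadratic form
of a compact symmetric operator is bounded by a constant smaller than `lam₀`. -/
theorem exists_re_inner_le_of_mem_orthogonal {T : F →L[ℂ] F} (hc : IsCompactOperator T)
    (hT : (T : F →ₗ[ℂ] F).IsSymmetric) {lam₀ : ℝ} (hpos : 0 < lam₀) :
    ∃ μ < lam₀, ∀ x ∈ (eigSum T (Set.Ici lam₀))ᗮ, (⟪T x, x⟫_ℂ).re ≤ μ * ‖x‖ ^ 2 := by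
  set G := (eigSum T (Set.Ici lam₀))ᗮ with hG
  have : CompleteSpace G := inferInstanceAs (CompleteSpace (eigSum T (Set.Ici lam₀))ᗮ)
  have hinv : ∀ x ∈ G, T x ∈ G := by
    intro x hx
    rw [hG, Submodule.mem_orthogonal] at hx ⊢
    intro y hy
    have := hT y x
    simp only [ContinuousLinearMap.coe_coe] at this
    rw [← this]
    exact hx _ (apply_mem_eigSum hy)
  let S : G →L[ℂ] G := T.restrict hinv
  have hSc : IsCompactOperator S := hc.restrict' hinv
  have hSs : (S : G →ₗ[ℂ] G).IsSymmetric := hT.restrict_invariant hinv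
  have hSa : IsSelfAdjoint S := hSs.isSelfAdjoint
  -- A spectral value `s ≥ lam₀ > 0` of the compact restriction would be an eigenvalue, whose
  -- eigenvector lies both in the spectral subspace and in its orthogonal complement. Compactness of
  -- the spectrum then makes the gap below `lam₀` uniform.
  have hlt : ∀ s ∈ spectrum ℝ S, s < lam₀ := by
    intro s hs
    by_contra! hle
    have hs0 : (s : ℂ) ≠ 0 := by exact_mod_cast (hpos.trans_le hle).ne'
    have hs' : (s : ℂ) ∈ spectrum ℂ S := by
      have := (spectrum.algebraMap_mem_iff ℂ (R := ℝ) (a := S) (r := s)).2 hs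
      simpa using this
    obtain ⟨y, hy⟩ := ((hSc.hasEigenvalue_iff_mem_spectrum hs0).2 hs').exists_hasEigenvector
    have hy1 : S y = (s : ℂ) • y := hy.apply_eq_smul
    have hy2 : T (y : F) = (s : ℂ) • (y : F) := congrArg Subtype.val hy1
    have hy3 : (y : F) ∈ eigSum T (Set.Ici lam₀) := mem_eigSum_of_apply_eq hle hy2
    have hy4 := Submodule.inner_right_of_mem_orthogonal hy3 y.2
    exact hy.2 (Subtype.ext (inner_self_eq_zero.1 hy4))
  obtain ⟨μ, hμ, hle⟩ : ∃ μ < lam₀, ∀ s ∈ spectrum ℝ S, s ≤ μ := by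
    rcases (spectrum ℝ S).eq_empty_or_nonempty with he | hne
    · exact ⟨0, hpos, by simp [he]⟩
    · obtain ⟨s, hs, hmax⟩ := (spectrum.isCompact (𝕜 := ℝ) S).exists_isGreatest hne
      exact ⟨s, hlt s hs, hmax⟩
  refine ⟨μ, hμ, fun x hx => ?_⟩
  exact re_inner_le_of_spectrum_le hSa hle ⟨x, hx⟩

/-- One half of the minimax principle. -/
theorem le_eigCount_Ici_of_form {T : F →L[ℂ] F} (hc : IsCompactOperator T)
    (hT : (T : F →ₗ[ℂ] F).IsSymmetric) {lam₀ : ℝ} (hpos : 0 < lam₀) {J : ℕ}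
    (h : ∀ μ < lam₀, ∃ W : Submodule ℂ F, (J : Cardinal) ≤ Module.rank ℂ W ∧
      ∀ x ∈ W, μ * ‖x‖ ^ 2 ≤ (⟪T x, x⟫_ℂ).re) :
    (J : Cardinal) ≤ eigCount T (Set.Ici lam₀) := by
  by_contra! hlt
  obtain ⟨μ', hμ', hG⟩ := exists_re_inner_le_of_mem_orthogonal hc hT hpos
  obtain ⟨μ, hμ1, hμ2⟩ := exists_between hμ'
  obtain ⟨W, hWr, hW⟩ := h μ hμ2
  set E := eigSum T (Set.Ici lam₀) with hE
  have hlt' : Module.rank ℂ E < (J : Cardinal) := hlt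
  have : FiniteDimensional ℂ E :=
    Module.rank_lt_aleph0_iff.1 (hlt'.trans (Cardinal.natCast_lt_aleph0))
  let P : W →ₗ[ℂ] E := (E.orthogonalProjectionOnto : F →ₗ[ℂ] E).comp W.subtype
  -- Dimension count: `W` is larger than `E`, so some nonzero vector of `W` is orthogonal to `E`.
  -- There the lower bound `μ` and the upper bound `μ' < μ` contradict each other.
  have hP : ¬ Function.Injective P := fun hinj =>
    absurd (hWr.trans (LinearMap.rank_le_of_injective P hinj)) (not_le.2 hlt')
  rw [← LinearMap.ker_eq_bot, Submodule.eq_bot_iff] at hP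
  push Not at hP
  obtain ⟨x, hx, hx0⟩ := hP
  have hxE : (x : F) ∈ Eᗮ := Submodule.orthogonalProjectionOnto_eq_zero_iff.1 hx
  have h1 := hG x hxE
  have h2 := hW x x.2
  have h3 : 0 < ‖(x : F)‖ ^ 2 := by
    have : (x : F) ≠ 0 := fun h => hx0 (Subtype.ext h)
    positivity
  nlinarith

/-- The supremum defining `eigval` is attained: the spectral subspaces for `μ` just below it are the
test subspaces in the form criterion, which needs only thresholds `μ < lam₀`. -/
theorem le_eigCount_Ici_eigval {T : F →L[ℂ] F} (hc : IsCompactOperator T)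
    (hT : (T : F →ₗ[ℂ] F).IsSymmetric) {J : ℕ} (hJ : 1 ≤ J)
    (h : (J : Cardinal) ≤ eigCount T (Set.Ioi 0)) :
    (J : Cardinal) ≤ eigCount T (Set.Ici (eigval J T)) := by
  obtain ⟨μ₀, -, hμ₀⟩ := exists_le_eigCount_Ici_of_Ioi h
  exact le_eigCount_Ici_of_form hc hT (eigval_pos hJ h) fun μ hμ =>
    ⟨eigSum T (Set.Ici μ), le_eigCount_Ici_of_lt_eigval ⟨μ₀, hμ₀⟩ hμ,
      fun x hx => le_re_inner_of_mem_eigSum hT hx⟩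

/-- Were `eigval J T` no eigenvalue, the spectral subspaces of `[eigval, ∞)` and `(eigval, ∞)` would
agree, and `J` eigenvalues would already lie above some larger `μ`. -/
theorem exists_eigenvector_eigval {T : F →L[ℂ] F} (hc : IsCompactOperator T)
    (hT : (T : F →ₗ[ℂ] F).IsSymmetric) {J : ℕ} (hJ : 1 ≤ J)
    (h : (J : Cardinal) ≤ eigCount T (Set.Ioi 0)) :
    ∃ x : F, x ≠ 0 ∧ T x = (eigval J T : ℂ) • x := by
  by_contra! hno
  have hle : eigSum T (Set.Ici (eigval J T)) ≤ eigSum T (Set.Ioi (eigval J T)) := by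
    refine iSup₂_le fun ν hν x hx => ?_
    have hx' := Module.End.mem_eigenspace_iff.1 hx
    rcases (Set.mem_Ici.1 hν).eq_or_lt with heq | hlt
    · by_cases hx0 : x = 0
      · rw [hx0]; exact Submodule.zero_mem _
      · exact absurd (by rw [heq]; exact hx') (hno x hx0)
    · exact mem_eigSum_of_apply_eq (Set.mem_Ioi.2 hlt) hx'
  obtain ⟨μ, hμ, hμJ⟩ := exists_le_eigCount_Ici_of_Ioi
    ((le_eigCount_Ici_eigval hc hT hJ h).trans (Submodule.rank_mono hle))
  exact absurd (le_eigval hJ hμJ) (not_le.2 hμ)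

/-- Weyl's inequality. -/
theorem eigval_sub_norm_le {T T' : F →L[ℂ] F} (hc : IsCompactOperator T)
    (hT : (T : F →ₗ[ℂ] F).IsSymmetric) (hc' : IsCompactOperator T')
    (hT' : (T' : F →ₗ[ℂ] F).IsSymmetric) {J : ℕ} (hJ : 1 ≤ J)
    (h : (J : Cardinal) ≤ eigCount T (Set.Ioi 0)) (h' : (J : Cardinal) ≤ eigCount T' (Set.Ioi 0)) :
    eigval J T - ‖T - T'‖ ≤ eigval J T' := by
  -- The form criterion requires a positive threshold; otherwise positivity of `eigval J T'`
  -- suffices.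
  rcases le_or_gt (eigval J T - ‖T - T'‖) 0 with hle | hgt
  · exact hle.trans (eigval_pos hJ h').le
  refine le_eigval hJ (le_eigCount_Ici_of_form hc' hT' hgt fun μ hμ =>
    ⟨eigSum T (Set.Ici (eigval J T)), le_eigCount_Ici_eigval hc hT hJ h, fun x hx => ?_⟩)
  have h1 := le_re_inner_of_mem_eigSum hT hx
  have h2 : (⟪(T - T') x, x⟫_ℂ).re ≤ ‖T - T'‖ * ‖x‖ ^ 2 := by
    calc (⟪(T - T') x, x⟫_ℂ).re ≤ ‖⟪(T - T') x, x⟫_ℂ‖ := Complex.re_le_norm _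
      _ ≤ ‖(T - T') x‖ * ‖x‖ := norm_inner_le_norm _ _
      _ ≤ ‖T - T'‖ * ‖x‖ * ‖x‖ := by gcongr; exact (T - T').le_opNorm x
      _ = _ := by ring
  rw [sub_apply, inner_sub_left, Complex.sub_re] at h2
  nlinarith [sq_nonneg ‖x‖]

theorem abs_eigval_sub_le {T T' : F →L[ℂ] F} (hc : IsCompactOperator T)
    (hT : (T : F →ₗ[ℂ] F).IsSymmetric) (hc' : IsCompactOperator T')
    (hT' : (T' : F →ₗ[ℂ] F).IsSymmetric) {J : ℕ} (hJ : 1 ≤ J)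
    (h : (J : Cardinal) ≤ eigCount T (Set.Ioi 0)) (h' : (J : Cardinal) ≤ eigCount T' (Set.Ioi 0)) :
    |eigval J T - eigval J T'| ≤ ‖T - T'‖ := by
  have h1 := eigval_sub_norm_le hc hT hc' hT' hJ h h'
  have h2 := eigval_sub_norm_le hc' hT' hc hT hJ h' h
  rw [norm_sub_rev] at h2
  exact abs_le.2 ⟨by linarith, by linarith⟩

end Compact

/-! ### The reduced operator: lower bound and interpolation -/

section Reduced

variable {m : ℕ} (V : EuclideanSpace ℂ (Fin m) →ₗᵢ[ℂ] Ell2)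

theorem inner_redOp (T : Ell2 →L[ℂ] Ell2) (a b : EuclideanSpace ℂ (Fin m)) :
    ⟪redOp V T a, b⟫_ℂ = ⟪T (V a), V b⟫_ℂ :=
  ContinuousLinearMap.adjoint_inner_left V.toContinuousLinearMap b (T (V a))

theorem redOp_isSymmetric {T : Ell2 →L[ℂ] Ell2} (hT : (T : Ell2 →ₗ[ℂ] Ell2).IsSymmetric) :
    (redOp V T : EuclideanSpace ℂ (Fin m) →ₗ[ℂ] EuclideanSpace ℂ (Fin m)).IsSymmetric := by
  intro a b
  change ⟪redOp V T a, b⟫_ℂ = ⟪a, redOp V T b⟫_ℂ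
  rw [inner_redOp, ← inner_conj_symm a, inner_redOp, inner_conj_symm]
  exact hT _ _

theorem redOp_apply_of_eigenvector {T : Ell2 →L[ℂ] Ell2} {a : EuclideanSpace ℂ (Fin m)} {c : ℂ}
    (h : T (V a) = c • V a) : redOp V T a = c • a := by
  refine ext_inner_right ℂ fun b => ?_
  rw [inner_redOp, h, inner_smul_left, inner_smul_left, V.inner_map_map]

/-- The isometry `V` preserves norms and transports the form, so it carries spectral subspaces of
the reduced operator to test subspaces for `T`. -/
theorem eigval_redOp_le {T : Ell2 →L[ℂ] Ell2} (hc : IsCompactOperator T)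
    (hT : (T : Ell2 →ₗ[ℂ] Ell2).IsSymmetric) {J : ℕ} (hJ : 1 ≤ J)
    (h : (J : Cardinal) ≤ eigCount T (Set.Ioi 0)) : eigval J (redOp V T) ≤ eigval J T := by
  -- The nonnegative bound also covers `m < J`, where the set is empty and its `sSup` is `0` by
  -- convention.
  refine Real.sSup_le (fun μ hμ => ?_) (eigval_pos hJ h).le
  rcases le_or_gt μ 0 with hle | hgt
  · exact hle.trans (eigval_pos hJ h).le
  refine le_eigval hJ (le_eigCount_Ici_of_form hc hT hgt fun μ' hμ' =>
    ⟨(eigSum (redOp V T) (Set.Ici μ)).map V.toLinearMap, ?_, ?_⟩)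
  · rw [LinearEquiv.rank_eq (Submodule.equivMapOfInjective V.toLinearMap V.injective _).symm]
    exact hμ
  · rintro _ ⟨a, ha, rfl⟩
    have h1 := le_re_inner_of_mem_eigSum (redOp_isSymmetric V hT) ha
    rw [inner_redOp] at h1
    have h2 : ‖V a‖ = ‖a‖ := V.norm_map a
    change μ' * ‖V a‖ ^ 2 ≤ (⟪T (V a), V a⟫_ℂ).re
    rw [h2]
    nlinarith [sq_nonneg ‖a‖]

/-- Hermite interpolation: the reduced eigenvalue is exact where the top eigenvectors are
included in the subspace. -/
theorem eigval_redOp_eq {T : Ell2 →L[ℂ] Ell2} (hc : IsCompactOperator T)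
    (hT : (T : Ell2 →ₗ[ℂ] Ell2).IsSymmetric) {J : ℕ} (hJ : 1 ≤ J)
    (h : (J : Cardinal) ≤ eigCount T (Set.Ioi 0)) {s : Fin J → Ell2}
    (hs : IsTopEigenvectors T s) (hsV : ∀ j, s j ∈ LinearMap.range V.toLinearMap) :
    eigval J (redOp V T) = eigval J T := by
  refine le_antisymm (eigval_redOp_le V hc hT hJ h) (le_eigval hJ ?_)
  choose a ha using hsV
  have ha' : ∀ j, V (a j) = s j := ha
  have hli : LinearIndependent ℂ a := by
    refine LinearIndependent.of_comp V.toLinearMap ?_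
    rw [show V.toLinearMap ∘ a = s from funext ha]
    exact hs.1
  have hne : ∃ μ : ℝ, (J : Cardinal) ≤ eigCount T (Set.Ici μ) :=
    ⟨_, le_eigCount_Ici_eigval hc hT hJ h⟩
  -- The index `j` runs from `0`, so `j + 1 ≤ J` and the corresponding eigenvalue is at least the
  -- `J`th.
  have hmem : ∀ j, a j ∈ eigSum (redOp V T) (Set.Ici (eigval J T)) := fun j =>
    mem_eigSum_of_apply_eq (ν := eigval (j + 1) T)
      (eigval_antitone (Nat.succ_le_succ (Nat.zero_le _)) (Nat.succ_le_of_lt j.2) hne)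
      (redOp_apply_of_eigenvector V (by rw [ha' j]; exact hs.2 j))
  exact Module.le_rank_iff.2 ⟨fun j => ⟨a j, hmem j⟩,
    LinearIndependent.of_comp (Submodule.subtype _) hli⟩

end Reduced

/-! ### Smooth dependence of a simple eigenvalue -/

section SimpleEigenvalue

variable {F : Type} [NormedAddCommGroup F] [InnerProductSpace ℂ F]

/-- The operator `y ↦ ⟪x, y⟫ x`. -/
noncomputable def selfRankOne (x : F) : F →L[ℂ] F := (innerSL ℂ x).smulRight x

theorem isCompactOperator_selfRankOne (x : F) : IsCompactOperator (selfRankOne x) := by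
  have h : IsCompactOperator (innerSL ℂ x) :=
    isCompactOperator_of_locallyCompactSpace_dom (innerSL ℂ x)
  exact h.clm_comp (ContinuousLinearMap.toSpanSingleton ℂ x)

theorem eq_zero_of_eigCount_singleton_eq_one {T : F →L[ℂ] F} {ν : ℝ}
    (h : eigCount T {ν} = 1) {x₀ x : F} (hx₀ : x₀ ≠ 0) (hTx₀ : T x₀ = (ν : ℂ) • x₀)
    (hTx : T x = (ν : ℂ) • x) (horth : ⟪x₀, x⟫_ℂ = 0) : x = 0 := by
  obtain ⟨v, hv⟩ := rank_le_one_iff.1 ((eigCount_eq_rank_eigSum T {ν}).symm.trans h).le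
  obtain ⟨r, hr⟩ := hv ⟨x, mem_eigSum_of_apply_eq (Set.mem_singleton ν) hTx⟩
  obtain ⟨r₀, hr₀⟩ := hv ⟨x₀, mem_eigSum_of_apply_eq (Set.mem_singleton ν) hTx₀⟩
  have e1 : r • (v : F) = x := congrArg Subtype.val hr
  have e2 : r₀ • (v : F) = x₀ := congrArg Subtype.val hr₀
  have hr₀' : r₀ ≠ 0 := by rintro rfl; exact hx₀ (by rw [← e2, zero_smul])
  have e3 : x = (r / r₀) • x₀ := by rw [← e1, ← e2, smul_smul, div_mul_cancel₀ _ hr₀']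
  rw [e3, inner_smul_right] at horth
  rcases mul_eq_zero.1 horth with h0 | h0
  · rw [e3, h0, zero_smul]
  · exact absurd (inner_self_eq_zero.1 h0) hx₀

/-- The scalar function whose level set describes a simple eigenvalue. -/
noncomputable def borderFun (x₀ : F) : (F →L[ℂ] F) →L[ℝ] ℝ :=
  Complex.reCLM.comp (((innerSL ℂ x₀).restrictScalars ℝ).comp
    ((ContinuousLinearMap.apply ℂ F x₀).restrictScalars ℝ))

/-- For `B = T - μ + x₀⟪x₀, ·⟫` the hypothesis on `x` holds for every eigenvector of `T` at `μ`.
Inverting gives `x = ⟪x₀, x⟫ B⁻¹x₀` with nonzero coefficient; pair with `x₀` and cancel. Eigenvalues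
therefore lie on a level set of `⟪x₀, B⁻¹x₀⟫`. -/
theorem inner_inverse_eq_one {B : F →L[ℂ] F} (hB : IsUnit B) {x₀ x : F} (hx : x ≠ 0)
    (h : B x = ⟪x₀, x⟫_ℂ • x₀) : ⟪x₀, Ring.inverse B x₀⟫_ℂ = 1 := by
  have h1 : x = ⟪x₀, x⟫_ℂ • Ring.inverse B x₀ := by
    rw [← map_smul, ← h]
    exact (congrArg (fun S : F →L[ℂ] F => S x) (Ring.inverse_mul_cancel B hB)).symm
  have hc : ⟪x₀, x⟫_ℂ ≠ 0 := by
    intro h0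
    rw [h0, zero_smul] at h1
    exact hx h1
  have h2 := congrArg (fun z => ⟪x₀, z⟫_ℂ) h1
  simp only [inner_smul_right] at h2
  exact (mul_left_cancel₀ hc (by rw [mul_one]; exact h2)).symm

variable [CompleteSpace F]

/-- The bordered operator at a simple nonzero eigenvalue is invertible. -/
theorem isUnit_sub_add_selfRankOne {T : F →L[ℂ] F} (hc : IsCompactOperator T)
    (hT : (T : F →ₗ[ℂ] F).IsSymmetric) {ν : ℝ} (hν : ν ≠ 0) (h : eigCount T {ν} = 1)
    {x₀ : F} (hx₀ : ‖x₀‖ = 1) (hTx₀ : T x₀ = (ν : ℂ) • x₀) :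
    IsUnit (T - (ν : ℂ) • (1 : F →L[ℂ] F) + selfRankOne x₀) := by
  have hν' : (ν : ℂ) ≠ 0 := by exact_mod_cast hν
  have hK : IsCompactOperator (T + selfRankOne x₀) := hc.add (isCompactOperator_selfRankOne x₀)
  -- Fredholm alternative. If `(T + x₀⟪x₀, ·⟫) y = ν y`, pairing with `x₀` gives `⟪x₀, y⟫ = 0`; then
  -- `y` is in the one-dimensional eigenspace and orthogonal to it, hence zero.
  rcases hK.hasEigenvalue_or_mem_resolventSet hν' with he | hr
  · obtain ⟨y, hy⟩ := he.exists_hasEigenvector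
    have hy1 : T y + ⟪x₀, y⟫_ℂ • x₀ = (ν : ℂ) • y := hy.apply_eq_smul
    have hx₀' : x₀ ≠ 0 := by rintro rfl; simp at hx₀
    have horth : ⟪x₀, y⟫_ℂ = 0 := by
      have h1 := congrArg (fun z => ⟪x₀, z⟫_ℂ) hy1
      have h2 : ⟪x₀, T y⟫_ℂ = (ν : ℂ) * ⟪x₀, y⟫_ℂ := by
        have := hT x₀ y
        simp only [ContinuousLinearMap.coe_coe] at this
        rw [← this, hTx₀, inner_smul_left, Complex.conj_ofReal]
      simp only [inner_add_right, inner_smul_right, h2, inner_self_eq_norm_sq_to_K, hx₀] at h1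
      simpa using h1
    rw [horth, zero_smul, add_zero] at hy1
    exact absurd (eq_zero_of_eigCount_singleton_eq_one h hx₀' hTx₀ hy1 horth) hy.2
  · have h1 : IsUnit (algebraMap ℂ (F →L[ℂ] F) ν - (T + selfRankOne x₀)) := hr
    have h2 : T - (ν : ℂ) • (1 : F →L[ℂ] F) + selfRankOne x₀
        = -(algebraMap ℂ (F →L[ℂ] F) ν - (T + selfRankOne x₀)) := by
      rw [Algebra.algebraMap_eq_smul_one]; abel
    rw [h2]
    exact h1.neg

/-- A simple positive eigenvalue of a smooth family of compact symmetric operators is smooth. -/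
theorem contDiffAt_eigval_of_simple {E : Type} [NormedAddCommGroup E] [NormedSpace ℝ E]
    [CompleteSpace E] {n : WithTop ℕ∞} (hn : n ≠ 0) {T : E → F →L[ℂ] F} {a : E}
    (hT : ContDiffAt ℝ n T a)
    {J : ℕ} (hJ : 1 ≤ J)
    (hgood : ∀ᶠ z in 𝓝 a, IsCompactOperator (T z) ∧ (T z : F →ₗ[ℂ] F).IsSymmetric ∧
      (J : Cardinal) ≤ eigCount (T z) (Set.Ioi 0))
    (hs : eigCount (T a) {eigval J (T a)} = 1) :
    ContDiffAt ℝ n (fun z => eigval J (T z)) a := by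
  set ν : E → ℝ := fun z => eigval J (T z) with hνdef
  obtain ⟨hca, hsa, hpa⟩ := hgood.self_of_nhds
  have hνpos : 0 < ν a := eigval_pos hJ hpa
  -- Weyl's inequality gives continuity, which keeps `(z, ν z)` in the neighbourhood where the
  -- implicit function is the unique solution.
  have hνcont : ContinuousAt ν a := by
    have h0 : Tendsto (fun z => ‖T z - T a‖) (𝓝 a) (𝓝 0) :=
      tendsto_iff_norm_sub_tendsto_zero.1 hT.continuousAt
    refine tendsto_iff_norm_sub_tendsto_zero.2 (squeeze_zero' (by simp) ?_ h0)
    filter_upwards [hgood] with z hz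
    exact abs_eigval_sub_le hz.1 hz.2.1 hca hsa hJ hz.2.2 hpa
  obtain ⟨x₀, hx₀, hTx₀⟩ : ∃ x₀ : F, ‖x₀‖ = 1 ∧ T a x₀ = (ν a : ℂ) • x₀ := by
    obtain ⟨x, hx, hTx⟩ := exists_eigenvector_eigval hca hsa hJ hpa
    refine ⟨((‖x‖⁻¹ : ℝ) : ℂ) • x, ?_, ?_⟩
    · rw [norm_smul, Complex.norm_real, norm_inv, norm_norm,
        inv_mul_cancel₀ (norm_ne_zero_iff.2 hx)]
    · rw [map_smul, hTx, smul_comm]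
  let B : E × ℝ → F →L[ℂ] F := fun v =>
    T v.1 - (v.2 : ℂ) • (1 : F →L[ℂ] F) + selfRankOne x₀
  have hBunit : IsUnit (B (a, ν a)) := isUnit_sub_add_selfRankOne hca hsa hνpos.ne' hs hx₀ hTx₀
  have hB : ContDiffAt ℝ n B (a, ν a) := by
    refine ContDiffAt.add (ContDiffAt.sub ?_ ?_) contDiffAt_const
    · exact ContDiffAt.comp (g := T) (f := Prod.fst) (a, ν a) hT contDiffAt_fst
    · exact (Complex.ofRealCLM.contDiff.contDiffAt.comp _ contDiffAt_snd).smul contDiffAt_const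
  have hBu : ∀ᶠ v in 𝓝 (a, ν a), IsUnit (B v) :=
    hB.continuousAt.eventually (Units.isOpen.mem_nhds hBunit)
  let g : E × ℝ → ℝ := fun v => borderFun x₀ (Ring.inverse (B v))
  have hg : ContDiffAt ℝ n g (a, ν a) := by
    have hi : ContDiffAt ℝ n Ring.inverse (B (a, ν a)) := by
      obtain ⟨u, hu⟩ := hBunit
      rw [← hu]
      exact contDiffAt_ringInverse ℝ u
    exact (borderFun x₀).contDiff.contDiffAt.comp _ (hi.comp _ hB)
  have hpair : Tendsto (fun z => (z, ν z)) (𝓝 a) (𝓝 (a, ν a)) :=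
    continuousAt_id.prodMk hνcont
  have hgν : ∀ᶠ z in 𝓝 a, g (z, ν z) = 1 := by
    filter_upwards [hgood, hpair.eventually hBu] with z hz hu
    obtain ⟨x, hx, hTx⟩ := exists_eigenvector_eigval hz.1 hz.2.1 hJ hz.2.2
    have hBx : B (z, ν z) x = ⟪x₀, x⟫_ℂ • x₀ := by
      change T z x - (ν z : ℂ) • x + ⟪x₀, x⟫_ℂ • x₀ = _
      rw [hTx, sub_self, zero_add]
    change (⟪x₀, Ring.inverse (B (z, ν z)) x₀⟫_ℂ).re = 1
    rw [inner_inverse_eq_one hu hx hBx, Complex.one_re]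
  -- At the base point `x₀` is an eigenvector of `B (a, μ)` for `1 + ν a - μ`, so `g` is explicit in
  -- `μ` with derivative `1` at `ν a`: the nondegeneracy needed for the implicit function theorem.
  have hgμ : ∀ᶠ μ in 𝓝 (ν a), g (a, μ) = (1 + ν a - μ)⁻¹ := by
    have h1 : Tendsto (fun μ : ℝ => (a, μ)) (𝓝 (ν a)) (𝓝 (a, ν a)) :=
      continuousAt_const.prodMk continuousAt_id
    have h2 : ∀ᶠ μ in 𝓝 (ν a), μ < 1 + ν a := eventually_lt_nhds (by linarith)
    filter_upwards [h1.eventually hBu, h2] with μ hu hμ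
    have hne : ((1 + ν a - μ : ℝ) : ℂ) ≠ 0 := by exact_mod_cast (by linarith : 1 + ν a - μ ≠ 0)
    have hBx : B (a, μ) x₀ = ((1 + ν a - μ : ℝ) : ℂ) • x₀ := by
      change T a x₀ - (μ : ℂ) • x₀ + ⟪x₀, x₀⟫_ℂ • x₀ = _
      rw [hTx₀, inner_self_eq_norm_sq_to_K, hx₀]
      push_cast
      module
    have h3 : Ring.inverse (B (a, μ)) x₀ = ((1 + ν a - μ : ℝ) : ℂ)⁻¹ • x₀ := by
      have h4 : Ring.inverse (B (a, μ)) (B (a, μ) x₀) = x₀ :=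
        congrArg (fun S : F →L[ℂ] F => S x₀) (Ring.inverse_mul_cancel _ hu)
      rw [hBx, map_smul] at h4
      rw [eq_inv_smul_iff₀ hne, h4]
    change (⟪x₀, Ring.inverse (B (a, μ)) x₀⟫_ℂ).re = _
    rw [h3, inner_smul_right, inner_self_eq_norm_sq_to_K, hx₀, ← Complex.ofReal_inv]
    rw [RCLike.ofReal_one, one_pow, mul_one, Complex.ofReal_re]
  have hderiv : fderiv ℝ g (a, ν a) ∘L .inr ℝ E ℝ = ContinuousLinearMap.id ℝ ℝ := by
    have hfd : HasFDerivAt g (fderiv ℝ g (a, ν a)) (a, ν a) :=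
      (hg.differentiableAt hn).hasFDerivAt
    have h1 : HasFDerivAt (fun μ => g (a, μ)) (fderiv ℝ g (a, ν a) ∘L .inr ℝ E ℝ) (ν a) :=
      HasFDerivAt.comp (ν a) hfd (hasFDerivAt_prodMk_right a (ν a))
    have h2 : HasDerivAt (fun μ => g (a, μ)) 1 (ν a) := by
      have h3 : HasDerivAt (fun μ : ℝ => (1 + ν a - μ)⁻¹) 1 (ν a) := by
        have h4 := ((hasDerivAt_id (ν a)).const_sub (1 + ν a)).inv (by simp)
        convert! h4 using 1
        simp
      exact h3.congr_of_eventuallyEq hgμ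
    have h5 := h1.unique h2.hasFDerivAt
    rw [h5]
    ext
    simp
  have hinv : (fderiv ℝ g (a, ν a) ∘L .inr ℝ E ℝ).IsInvertible := by
    rw [hderiv]
    exact ⟨ContinuousLinearEquiv.refl ℝ ℝ, rfl⟩
  have hiff := hpair.eventually (hg.eventually_apply_eq_iff_implicitFunction hn hinv)
  have hga : g (a, ν a) = 1 := hgν.self_of_nhds
  refine (hg.contDiffAt_implicitFunction hn hinv).congr_of_eventuallyEq ?_
  filter_upwards [hiff, hgν] with z hz hz1
  exact (hz.1 (by rw [hz1, hga])).symm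

end SimpleEigenvalue

/-! ### Comparison of second derivatives along a line -/

section Line

variable {E : Type} [NormedAddCommGroup E] [NormedSpace ℝ E]

theorem hasDerivAt_iteratedFDeriv_line {f : E → ℝ} {n : ℕ} {x v : E} {t : ℝ}
    (hf : DifferentiableAt ℝ (iteratedFDeriv ℝ n f) (x + t • v)) :
    HasDerivAt (fun s : ℝ => iteratedFDeriv ℝ n f (x + s • v) fun _ => v)
      (iteratedFDeriv ℝ (n + 1) f (x + t • v) fun _ => v) t := by
  have h1 : HasDerivAt (fun s : ℝ => x + s • v) v t := by
    simpa using ((hasDerivAt_id t).smul_const v).const_add x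
  have h2 := hf.hasFDerivAt.comp_hasDerivAt t h1
  exact ((ContinuousMultilinearMap.apply ℝ (fun _ : Fin n => E) ℝ fun _ => v).hasFDerivAt).comp_hasDerivAt
    t h2

/-- If two functions agree to first order at `x` along `v` and agree at `x + h v`, then their second
derivatives along `v` at `x` differ by `O(h)`. -/
theorem abs_iteratedFDeriv_two_sub_le {f g : E → ℝ} {x v : E} {h K L : ℝ} (hh : 0 < h)
    (hf : ∀ i < 3, ∀ t ∈ Set.Icc 0 h, DifferentiableAt ℝ (iteratedFDeriv ℝ i f) (x + t • v))
    (hg : ∀ i < 3, ∀ t ∈ Set.Icc 0 h, DifferentiableAt ℝ (iteratedFDeriv ℝ i g) (x + t • v))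
    (h0 : f x = g x) (h0' : f (x + h • v) = g (x + h • v)) (h1 : fderiv ℝ f x = fderiv ℝ g x)
    (hK : ∀ t ∈ Set.Icc 0 h, |iteratedFDeriv ℝ 3 f (x + t • v) fun _ => v| ≤ K)
    (hL : ∀ t ∈ Set.Icc 0 h, |iteratedFDeriv ℝ 3 g (x + t • v) fun _ => v| ≤ L) :
    |(iteratedFDeriv ℝ 2 f x fun _ => v) - iteratedFDeriv ℝ 2 g x fun _ => v| ≤ (K + L) * h := by
  set ψ : ℕ → ℝ → ℝ := fun i t => (iteratedFDeriv ℝ i f (x + t • v) fun _ => v)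
    - iteratedFDeriv ℝ i g (x + t • v) fun _ => v with hψ
  have hd : ∀ i < 3, ∀ t ∈ Set.Icc 0 h, HasDerivAt (ψ i) (ψ (i + 1) t) t := fun i hi t ht =>
    (hasDerivAt_iteratedFDeriv_line (hf i hi t ht)).sub
      (hasDerivAt_iteratedFDeriv_line (hg i hi t ht))
  have hψ0 : ψ 0 0 = 0 := by simp [hψ, h0]
  have hψh : ψ 0 h = 0 := by simp [hψ, h0']
  have hψ1 : ψ 1 0 = 0 := by simp [hψ, iteratedFDeriv_one_apply, h1]
  -- Rolle on `[0, h]` gives a zero `a` of `ψ 1`; with `ψ 1 0 = 0`, Rolle on `[0, a]` gives a zero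
  -- `b` of `ψ 2`. The mean value theorem on `[0, b]` then bounds `ψ 2 0`.
  obtain ⟨a, ha, ha0⟩ := exists_hasDerivAt_eq_zero (f' := ψ 1) hh
    (fun t ht => (hd 0 (by norm_num) t ht).continuousAt.continuousWithinAt) (hψ0.trans hψh.symm)
    (fun t ht => hd 0 (by norm_num) t (Set.Ioo_subset_Icc_self ht))
  have hsub : Set.Icc 0 a ⊆ Set.Icc 0 h := Set.Icc_subset_Icc_right ha.2.le
  obtain ⟨b, hb, hb0⟩ := exists_hasDerivAt_eq_zero (f' := ψ 2) ha.1
    (fun t ht => (hd 1 (by norm_num) t (hsub ht)).continuousAt.continuousWithinAt)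
    (hψ1.trans ha0.symm)
    (fun t ht => hd 1 (by norm_num) t (hsub (Set.Ioo_subset_Icc_self ht)))
  have hsub' : Set.Icc 0 b ⊆ Set.Icc 0 h := (Set.Icc_subset_Icc_right hb.2.le).trans hsub
  obtain ⟨c, hc, hcs⟩ := exists_hasDerivAt_eq_slope (ψ 2) (ψ 3) hb.1
    (fun t ht => (hd 2 (by norm_num) t (hsub' ht)).continuousAt.continuousWithinAt)
    (fun t ht => hd 2 (by norm_num) t (hsub' (Set.Ioo_subset_Icc_self ht)))
  have hcI := hsub' (Set.Ioo_subset_Icc_self hc)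
  have hψ3 : |ψ 3 c| ≤ K + L := (abs_sub _ _).trans (add_le_add (hK c hcI) (hL c hcI))
  have hψ2 : ψ 2 0 = -(ψ 3 c * b) := by
    rw [hcs, hb0]
    field_simp [hb.1.ne']
    ring
  have hgoal : ((iteratedFDeriv ℝ 2 f x fun _ => v) - iteratedFDeriv ℝ 2 g x fun _ => v) = ψ 2 0 := by
    simp [hψ]
  rw [hgoal, hψ2, abs_neg, abs_mul, abs_of_pos hb.1]
  exact mul_le_mul hψ3 (hb.2.le.trans ha.2.le) hb.1.le ((abs_nonneg _).trans hψ3)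

theorem contDiffAt_two_of_differentiableOn {f : E → ℝ} {s : Set E} (hs : IsOpen s)
    (hf : ∀ i < 3, DifferentiableOn ℝ (iteratedFDeriv ℝ i f) s) {x : E} (hx : x ∈ s) :
    ContDiffAt ℝ 2 f x := by
  have h : ContDiffOn ℝ ((2 : ℕ∞) : WithTop ℕ∞) f s := by
    refine contDiffOn_of_differentiableOn fun m hm => ?_
    have hm' : m ≤ 2 := by exact_mod_cast hm
    exact (hf m (by omega)).congr (iteratedFDerivWithin_of_isOpen m hs)
  exact h.contDiffAt (hs.mem_nhds hx)

theorem exists_eventually_contDiffAt_three_and_norm_le {f : E → ℝ} {a : E} (hf : ContDiffAt ℝ 3 f a) :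
    ∃ K, ∀ᶠ x in 𝓝 a, ContDiffAt ℝ 3 f x ∧ ‖iteratedFDeriv ℝ 3 f x‖ ≤ K := by
  refine ⟨‖iteratedFDeriv ℝ 3 f a‖ + 1, (hf.eventually (by norm_num)).and ?_⟩
  have h := (hf.continuousAt_iteratedFDeriv (k := 3) le_rfl).norm
  exact (h.eventually (eventually_lt_nhds (lt_add_one _))).mono fun x hx => hx.le

end Line

/-! ### Coordinates, Hessian matrices and the spectral norm -/

section Coordinates

variable {d : ℕ}

theorem sum_smul_unitVec (v : Param d) : ∑ p, v p • unitVec p = v := by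
  have := (EuclideanSpace.basisFun (Fin d) ℝ).sum_repr v
  simpa [unitVec] using this

theorem abs_apply_le_of_norm_le_one {v : Param d} (hv : ‖v‖ ≤ 1) (p : Fin d) : |v p| ≤ 1 :=
  (PiLp.norm_apply_le v p).trans hv

theorem norm_unitVec (p : Fin d) : ‖unitVec p‖ = 1 := by simp [unitVec]

theorem norm_dirVec_le (p q : Fin d) : ‖dirVec p q‖ ≤ 1 := by
  unfold dirVec
  split_ifs with h
  · exact (norm_unitVec p).le
  · have h0 : inner ℝ (unitVec p) (unitVec q) = 0 := by
      simp [unitVec, EuclideanSpace.inner_single_left, h]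
    have h1 : ‖unitVec p + unitVec q‖ = Real.sqrt 2 := by
      rw [eq_comm, Real.sqrt_eq_iff_mul_self_eq_of_pos (by
        rw [norm_pos_iff]; intro h2
        have := congrArg (fun z => inner ℝ (unitVec p) z) h2
        simp [inner_add_right, h0, norm_unitVec] at this)]
      rw [norm_add_sq_eq_norm_sq_add_norm_sq_real h0, norm_unitVec, norm_unitVec]
      norm_num
    rw [norm_smul, h1, Real.norm_of_nonneg (by positivity)]
    rw [one_div, inv_mul_cancel₀ (by positivity)]

/-- A bound for a multilinear form on unit coordinate vectors gives a bound on the unit ball. -/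
theorem abs_multilinear_diag_le {n : ℕ} (φ : ContinuousMultilinearMap ℝ (fun _ : Fin n => Param d) ℝ)
    {M : ℝ} (hM : ∀ r : Fin n → Fin d, |φ fun i => unitVec (r i)| ≤ M) {v : Param d}
    (hv : ‖v‖ ≤ 1) : |φ fun _ => v| ≤ d ^ n * M := by
  have h1 : (φ fun _ => v) = ∑ r : Fin n → Fin d, (∏ i, v (r i)) * φ fun i => unitVec (r i) := by
    conv_lhs => rw [← sum_smul_unitVec v]
    rw [ContinuousMultilinearMap.map_sum]
    refine Finset.sum_congr rfl fun r _ => ?_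
    rw [ContinuousMultilinearMap.map_smul_univ, smul_eq_mul]
  rw [h1]
  refine (Finset.abs_sum_le_sum_abs _ _).trans ?_
  have h2 : ∀ r ∈ (Finset.univ : Finset (Fin n → Fin d)),
      |(∏ i, v (r i)) * φ fun i => unitVec (r i)| ≤ M := by
    intro r _
    rw [abs_mul, Finset.abs_prod]
    calc (∏ i, |v (r i)|) * |φ fun i => unitVec (r i)| ≤ 1 * |φ fun i => unitVec (r i)| := by
          gcongr
          exact Finset.prod_le_one (fun _ _ => abs_nonneg _)
            fun i _ => abs_apply_le_of_norm_le_one hv _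
      _ ≤ M := by rw [one_mul]; exact hM r
  refine (Finset.sum_le_card_nsmul _ _ M h2).trans (le_of_eq ?_)
  simp

/-- The polarization identity recovers a symmetric bilinear form from its values on the directions
`e_pq`. -/
theorem abs_bilin_unitVec_le {L : Param d →L[ℝ] Param d →L[ℝ] ℝ} (hL : ∀ v w, L v w = L w v)
    {c : ℝ} (h : ∀ p q : Fin d, p ≤ q → |L (dirVec p q) (dirVec p q)| ≤ c) (p q : Fin d) :
    |L (unitVec p) (unitVec q)| ≤ 2 * c := by
  have hdiag : ∀ p : Fin d, |L (unitVec p) (unitVec p)| ≤ c := fun p => by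
    simpa [dirVec] using h p p le_rfl
  have hlt : ∀ p q : Fin d, p < q → |L (unitVec p) (unitVec q)| ≤ 2 * c := by
    intro p q hpq
    have h1 := h p q hpq.le
    -- The factor `2` in the bound: one `c` from the form on `e_pq`, one from the mean of the two
    -- diagonal entries.
    have h2 : L (dirVec p q) (dirVec p q) = (L (unitVec p) (unitVec p)
        + L (unitVec q) (unitVec q)) / 2 + L (unitVec p) (unitVec q) := by
      have hs : (Real.sqrt 2)⁻¹ * (Real.sqrt 2)⁻¹ = 1 / 2 := by
        rw [← mul_inv, Real.mul_self_sqrt (by norm_num)]; norm_num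
      simp only [dirVec, hpq.ne, if_false, map_smul, map_add, smul_apply,
        add_apply, smul_eq_mul, hL (unitVec q) (unitVec p), one_div]
      linear_combination (L (unitVec p) (unitVec p) + L (unitVec q) (unitVec q)
        + 2 * L (unitVec p) (unitVec q)) * hs
    rw [h2] at h1
    have h3 := abs_le.1 h1
    have h4 := abs_le.1 (hdiag p)
    have h5 := abs_le.1 (hdiag q)
    exact abs_le.2 ⟨by linarith, by linarith⟩
  rcases lt_trichotomy p q with hpq | rfl | hpq
  · exact hlt p q hpq
  · have h1 := hdiag p
    have h2 := (abs_nonneg _).trans h1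
    linarith
  · rw [hL]; exact hlt q p hpq

theorem hessian_apply (g : Param d → ℝ) (x : Param d) (p q : Fin d) :
    hessian g x p q = fderiv ℝ (fderiv ℝ g) x (unitVec p) (unitVec q) := by
  simp [hessian, iteratedFDeriv_two_apply]

/-- Closeness of the second derivatives along the directions `e_pq` gives closeness of the
Hessians. -/
theorem abs_hessian_sub_le {f g : Param d → ℝ} {x : Param d} (hf : ContDiffAt ℝ 2 f x)
    (hg : ContDiffAt ℝ 2 g x) {c : ℝ}
    (h : ∀ p q : Fin d, p ≤ q → |(iteratedFDeriv ℝ 2 f x fun _ => dirVec p q)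
      - iteratedFDeriv ℝ 2 g x fun _ => dirVec p q| ≤ c) (p q : Fin d) :
    |hessian f x p q - hessian g x p q| ≤ 2 * c := by
  have hsf := hf.isSymmSndFDerivAt (by simp)
  have hsg := hg.isSymmSndFDerivAt (by simp)
  have := abs_bilin_unitVec_le (L := fderiv ℝ (fderiv ℝ f) x - fderiv ℝ (fderiv ℝ g) x) (c := c)
    (fun v w => by simp [hsf v w, hsg v w])
    (fun p q hpq => by simpa [iteratedFDeriv_two_apply] using h p q hpq) p q
  simpa [hessian_apply] using this

/-- Cauchy–Schwarz in each row gives `(M x)_i² ≤ d c² ‖x‖²`; summing over `d` rows gives `d² c²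
‖x‖²`. -/
theorem specNorm_le {M : Matrix (Fin d) (Fin d) ℝ} {c : ℝ} (hc : 0 ≤ c) (h : ∀ p q, |M p q| ≤ c) :
    specNorm M ≤ d * c := by
  refine ContinuousLinearMap.opNorm_le_bound _ (by positivity) fun x => ?_
  refine le_of_sq_le_sq ?_ (by positivity)
  rw [EuclideanSpace.real_norm_sq_eq]
  have h1 : ∀ i ∈ (Finset.univ : Finset (Fin d)),
      (Matrix.toEuclideanCLM (n := Fin d) (𝕜 := ℝ) M x i) ^ 2 ≤ d * c ^ 2 * ‖x‖ ^ 2 := by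
    intro i _
    have e : Matrix.toEuclideanCLM (n := Fin d) (𝕜 := ℝ) M x i = ∑ j, M i j * x j := rfl
    rw [e, EuclideanSpace.real_norm_sq_eq x]
    refine (Finset.sum_mul_sq_le_sq_mul_sq _ _ _).trans ?_
    gcongr
    refine (Finset.sum_le_card_nsmul _ _ (c ^ 2) fun j _ => ?_).trans (le_of_eq (by simp))
    rw [← sq_abs]
    gcongr
    exact h i j
  refine (Finset.sum_le_card_nsmul _ _ _ h1).trans (le_of_eq ?_)
  simp
  ring

theorem tendsto_hessian {g : Param d → ℝ} {a : Param d} (hg : ContDiffAt ℝ 2 g a) :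
    Tendsto (hessian g) (𝓝 a) (𝓝 (hessian g a)) := by
  refine tendsto_pi_nhds.2 fun p => tendsto_pi_nhds.2 fun q => ?_
  have h := hg.continuousAt_iteratedFDeriv (k := 2) le_rfl
  exact ((ContinuousMultilinearMap.apply ℝ (fun _ : Fin 2 => Param d) ℝ
    ![unitVec p, unitVec q]).continuous.tendsto _).comp h

open scoped Matrix.Norms.L2Operator in
/-- Matrix inversion is locally Lipschitz for the spectral norm. -/
theorem exists_specNorm_inv_sub_le {H : Matrix (Fin d) (Fin d) ℝ} (hH : IsUnit H) :
    ∃ K : ℝ, 0 < K ∧ ∃ ε > 0, ∃ U ∈ 𝓝 H, ∀ A ∈ U, ∀ B, specNorm (A - B) < ε →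
      IsUnit A ∧ IsUnit B ∧ specNorm (A⁻¹ - B⁻¹) ≤ K * specNorm (A - B) := by
  have hs : ∀ A : Matrix (Fin d) (Fin d) ℝ, specNorm A = ‖A‖ := fun A => rfl
  have hcd : ContDiffAt ℝ 1 (Ring.inverse : Matrix (Fin d) (Fin d) ℝ → _) H := by
    obtain ⟨u, hu⟩ := hH
    rw [← hu]
    exact contDiffAt_ringInverse ℝ u
  obtain ⟨K, t, ht, hK⟩ := hcd.exists_lipschitzOnWith
  obtain ⟨ε, hε, hball⟩ := Metric.mem_nhds_iff.1
    (inter_mem ht (Units.isOpen.mem_nhds (show H ∈ {x | IsUnit x} from hH)))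
  -- Inversion is C¹ at a unit, hence `K`-Lipschitz nearby. Halving `ε` keeps `B` in the same ball
  -- as `A`; `K + 1` makes the constant strictly positive.
  refine ⟨K + 1, by positivity, ε / 2, by positivity, Metric.ball H (ε / 2),
    Metric.ball_mem_nhds _ (by positivity), fun A hA B hAB => ?_⟩
  rw [hs] at hAB
  have hA' : A ∈ Metric.ball H ε := Metric.ball_subset_ball (by linarith) hA
  have hB' : B ∈ Metric.ball H ε := by
    have h1 := dist_triangle B A H
    rw [dist_eq_norm B A, norm_sub_rev] at h1
    have h2 := Metric.mem_ball.1 hA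
    exact Metric.mem_ball.2 (by linarith)
  refine ⟨(hball hA').2, (hball hB').2, ?_⟩
  have h1 := hK.dist_le_mul A (hball hA').1 B (hball hB').1
  rw [hs, hs, Matrix.nonsing_inv_eq_ringInverse, Matrix.nonsing_inv_eq_ringInverse]
  rw [dist_eq_norm, dist_eq_norm] at h1
  nlinarith [norm_nonneg (A - B)]

end Coordinates

/-! ### Specialization to the family `𝐀(ω)` -/

section Family

variable {d κ J : ℕ} {f : Fin κ → Param d → ℝ} {A : Fin κ → Ell2 →L[ℂ] Ell2}

theorem isCompactOperator_opFun (hA : ∀ l, IsCompactOperator (A l)) (ω : Param d) :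
    IsCompactOperator (opFun f A ω) := by
  have h : ∀ s : Finset (Fin κ),
      IsCompactOperator (∑ l ∈ s, ((f l ω : ℝ) : ℂ) • A l : Ell2 →L[ℂ] Ell2) := by
    intro s
    induction s using Finset.cons_induction with
    | empty => exact isCompactOperator_zero
    | cons l s hl ih =>
      rw [Finset.sum_cons]
      exact ((hA l).smul _).add ih
  exact h Finset.univ

theorem opFun_isSymmetric (hA : ∀ l, IsSelfAdjoint (A l)) (ω : Param d) :
    (opFun f A ω : Ell2 →ₗ[ℂ] Ell2).IsSymmetric := by
  have h : IsSelfAdjoint (opFun f A ω) := by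
    refine isSelfAdjoint_sum _ fun l _ => IsSelfAdjoint.smul ?_ (hA l)
    exact Complex.conj_ofReal _
  exact h.isSymmetric

theorem contDiffAt_opFun {n : WithTop ℕ∞} {a : Param d} (hf : ∀ l, ContDiffAt ℝ n (f l) a) :
    ContDiffAt ℝ n (opFun f A) a := by
  unfold opFun
  exact ContDiffAt.sum fun l _ =>
    (Complex.ofRealCLM.contDiff.contDiffAt.comp a (hf l)).smul contDiffAt_const

theorem contDiffAt_lam {n : WithTop ℕ∞} (hn : n ≠ 0) {Ω : Set (Param d)} (hJ : 1 ≤ J)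
    (hAc : ∀ l, IsCompactOperator (A l)) (hAs : ∀ l, IsSelfAdjoint (A l))
    (hpos : ∀ ω ∈ Ω, (J : Cardinal) ≤ eigCount (opFun f A ω) (Set.Ioi 0))
    {a : Param d} (hf : ∀ l, ContDiffAt ℝ n (f l) a) (ha : a ∈ interior Ω)
    (hs : eigCount (opFun f A a) {lam f A J a} = 1) : ContDiffAt ℝ n (lam f A J) a :=
  contDiffAt_eigval_of_simple hn (contDiffAt_opFun hf) hJ
    (Filter.Eventually.mono (mem_interior_iff_mem_nhds.1 ha) fun ω hω =>
      ⟨isCompactOperator_opFun hAc ω, opFun_isSymmetric hAs ω, hpos ω hω⟩) hs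

theorem redLam_le_lam (hJ : 1 ≤ J) (hAc : ∀ l, IsCompactOperator (A l))
    (hAs : ∀ l, IsSelfAdjoint (A l)) {m : ℕ} (V : EuclideanSpace ℂ (Fin m) →ₗᵢ[ℂ] Ell2)
    {x : Param d} (hx : (J : Cardinal) ≤ eigCount (opFun f A x) (Set.Ioi 0)) :
    redLam f A J V x ≤ lam f A J x :=
  eigval_redOp_le V (isCompactOperator_opFun hAc x) (opFun_isSymmetric hAs x) hJ hx

theorem redLam_eq_lam (hJ : 1 ≤ J) (hAc : ∀ l, IsCompactOperator (A l))
    (hAs : ∀ l, IsSelfAdjoint (A l)) {m : ℕ} (V : EuclideanSpace ℂ (Fin m) →ₗᵢ[ℂ] Ell2)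
    {x : Param d} (hx : (J : Cardinal) ≤ eigCount (opFun f A x) (Set.Ioi 0)) {s : Fin J → Ell2}
    (hs : IsTopEigenvectors (opFun f A x) s)
    (hsV : Submodule.span ℂ (Set.range s) ≤ LinearMap.range V.toLinearMap) :
    redLam f A J V x = lam f A J x :=
  eigval_redOp_eq V (isCompactOperator_opFun hAc x) (opFun_isSymmetric hAs x) hJ hx hs
    fun j => hsV (Submodule.subset_span ⟨j, rfl⟩)

end Family

/-! ### Interpolation points supplied by the two procedures -/

section Interpolation

variable {d κ J : ℕ} {f : Fin κ → Param d → ℝ} {A : Fin κ → Ell2 →L[ℂ] Ell2}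
  {D Ω : Set (Param d)} {ω : ℕ → Param d} {m : ℕ → ℕ}
  {V : (k : ℕ) → EuclideanSpace ℂ (Fin (m k)) →ₗᵢ[ℂ] Ell2}

/-- The data on the reduced eigenvalue function `g` at the iterate `x` which are used in the
comparison with `g₀`: interpolation at `x` and, for each `e_pq`, at `x + h v` for some
`v = ± e_pq`. -/
structure InterpolatesAlong (g g₀ : Param d → ℝ) (G : Set (Param d)) (x : Param d) (h : ℝ) :
    Prop where
  base : g x = g₀ x
  shifted : ∀ p q : Fin d, p ≤ q → ∃ v : Param d, (v = dirVec p q ∨ v = -dirVec p q) ∧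
    (x + h • v ∈ G → g (x + h • v) = g₀ (x + h • v))

theorem IsExtGreedyRun.interpolatesAlong (hrun : IsExtGreedyRun f A D Ω J ω m V) (hJ : 1 ≤ J)
    (hAc : ∀ l, IsCompactOperator (A l)) (hAs : ∀ l, IsSelfAdjoint (A l))
    (hpos : ∀ ω ∈ Ω, (J : Cardinal) ≤ eigCount (opFun f A ω) (Set.Ioi 0)) {k : ℕ} (hk : 2 ≤ k) :
    InterpolatesAlong (redLam f A J (V k)) (lam f A J) Ω (ω k) (stepLen ω k) := by
  obtain ⟨⟨hmem, -⟩, s, t, hs, ht, -, hrange⟩ := hrun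
  refine ⟨?_, fun p q hpq => ⟨dirVec p q, Or.inl rfl, fun hG => ?_⟩⟩
  · refine redLam_eq_lam hJ hAc hAs (V k) (hpos _ (hmem k (by omega))) (hs k (by omega)) ?_
    rw [hrange k hk]
    exact le_sup_right.trans le_sup_left
  · refine redLam_eq_lam hJ hAc hAs (V k) (hpos _ hG) (ht k hk p q hpq).2 ?_
    rw [hrange k hk]
    refine le_trans ?_ le_sup_right
    exact le_iSup₂_of_le p q (le_iSup_of_le hpq le_rfl)

theorem eq_or_eq_neg_unitVec_of_norm_eq_one {v : Param 1} (hv : ‖v‖ = 1) (p : Fin 1) :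
    v = unitVec p ∨ v = -unitVec p := by
  have h1 : v = v 0 • unitVec p := by
    rw [Subsingleton.elim p 0]
    simpa using (sum_smul_unitVec v).symm
  have h2 : v 0 ^ 2 = 1 := by
    have := EuclideanSpace.real_norm_sq_eq v
    simpa [hv] using this.symm
  rcases sq_eq_sq_iff_eq_or_eq_neg.1 (h2.trans (one_pow 2).symm) with h | h
  · left; rw [h1, h, one_smul]
  · right; rw [h1, h, neg_one_smul]

theorem IsGreedyRun.interpolatesAlong (hrun : IsGreedyRun f A Ω J ω m V) (hd : d = 1) (hJ : 1 ≤ J)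
    (hAc : ∀ l, IsCompactOperator (A l)) (hAs : ∀ l, IsSelfAdjoint (A l))
    (hpos : ∀ ω ∈ Ω, (J : Cardinal) ≤ eigCount (opFun f A ω) (Set.Ioi 0)) {k : ℕ} (hk : 2 ≤ k)
    (hh : 0 < stepLen ω k) :
    InterpolatesAlong (redLam f A J (V k)) (lam f A J) Ω (ω k) (stepLen ω k) := by
  subst hd
  obtain ⟨⟨hmem, -⟩, s, hs, hrange1, hrange⟩ := hrun
  -- In dimension one the preceding iterate is the shifted point: the normalized step back to it is
  -- `± e_1`, and its eigenvectors are still in the current subspace.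
  refine ⟨?_, fun p q hpq => ⟨(stepLen ω k)⁻¹ • (ω (k - 1) - ω k), ?_, fun _ => ?_⟩⟩
  · refine redLam_eq_lam hJ hAc hAs (V k) (hpos _ (hmem k (by omega))) (hs k (by omega)) ?_
    rw [hrange k hk]
    exact le_sup_right
  · rw [show dirVec p q = unitVec p by simp [dirVec, Subsingleton.elim p q]]
    refine eq_or_eq_neg_unitVec_of_norm_eq_one ?_ p
    rw [norm_smul, norm_inv, Real.norm_of_nonneg hh.le, norm_sub_rev]
    exact inv_mul_cancel₀ hh.ne'
  · rw [smul_inv_smul₀ hh.ne', add_sub_cancel]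
    refine redLam_eq_lam hJ hAc hAs (V k) (hpos _ (hmem (k - 1) (by omega)))
      (hs (k - 1) (by omega)) ?_
    rw [hrange k hk]
    refine le_trans ?_ le_sup_left
    rcases (show k - 1 = 1 ∨ 2 ≤ k - 1 by omega) with h1 | h1
    · rw [h1, hrange1]
    · rw [hrange (k - 1) h1]
      exact le_sup_right

end Interpolation

/-- The Hessians of two functions which are related by interpolation along the directions `e_pq`
at distance `h`, the second function being a lower bound for the first. -/
theorem InterpolatesAlong.abs_hessian_sub_le {d : ℕ} {g g₀ : Param d → ℝ} {G U : Set (Param d)}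
    {x : Param d} {h K M : ℝ} (hI : InterpolatesAlong g g₀ G x h) (hh : 0 < h)
    (hU : ∀ v : Param d, ‖v‖ ≤ 1 → ∀ t ∈ Set.Icc 0 h, x + t • v ∈ U) (hUo : IsOpen U)
    (hUG : U ⊆ G) (hle : ∀ y ∈ U, g y ≤ g₀ y)
    (hg₀ : ∀ y ∈ U, ContDiffAt ℝ 3 g₀ y ∧ ‖iteratedFDeriv ℝ 3 g₀ y‖ ≤ K)
    (hg : ∀ i < 3, DifferentiableOn ℝ (iteratedFDeriv ℝ i g) U)
    (hM : ∀ y ∈ U, ∀ p q l : Fin d,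
      |iteratedFDeriv ℝ 3 g y ![unitVec p, unitVec q, unitVec l]| ≤ M) (p q : Fin d) :
    |hessian g₀ x p q - hessian g x p q| ≤ 2 * ((K + d ^ 3 * M) * h) := by
  have hxU : x ∈ U := by simpa using hU 0 (by simp) 0 ⟨le_rfl, hh.le⟩
  have hg2 : ContDiffAt ℝ 2 g x := contDiffAt_two_of_differentiableOn hUo hg hxU
  have hg₀2 : ContDiffAt ℝ 2 g₀ x := (hg₀ x hxU).1.of_le (by norm_num)
  -- `g₀ - g` is nonnegative near `x` and zero at `x`, so its derivative vanishes there.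
  have hgrad : fderiv ℝ g₀ x = fderiv ℝ g x := by
    have hmin : IsLocalMin (fun y => g₀ y - g y) x := by
      filter_upwards [hUo.mem_nhds hxU] with y hy
      rw [hI.base, sub_self]
      exact sub_nonneg.2 (hle y hy)
    have h0 := hmin.fderiv_eq_zero
    rw [fderiv_fun_sub (hg₀2.differentiableAt (by norm_num)) (hg2.differentiableAt (by norm_num))]
      at h0
    exact sub_eq_zero.1 h0
  refine _root_.abs_hessian_sub_le hg₀2 hg2 (fun p q hpq => ?_) p q
  obtain ⟨v, hv, hvG⟩ := hI.shifted p q hpq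
  have hvn : ‖v‖ ≤ 1 := by
    rcases hv with rfl | rfl
    · exact norm_dirVec_le p q
    · rw [norm_neg]; exact norm_dirVec_le p q
  have key : |(iteratedFDeriv ℝ 2 g₀ x fun _ => v) - iteratedFDeriv ℝ 2 g x fun _ => v|
      ≤ (K + d ^ 3 * M) * h := by
    refine abs_iteratedFDeriv_two_sub_le hh (fun i hi t ht => ?_) (fun i hi t ht => ?_)
      hI.base.symm (hvG (hUG (hU v hvn h ⟨hh.le, le_rfl⟩))).symm hgrad (fun t ht => ?_)
      (fun t ht => ?_)
    · exact (hg₀ _ (hU v hvn t ht)).1.differentiableAt_iteratedFDeriv (by exact_mod_cast hi)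
    · exact (hg i hi).differentiableAt (hUo.mem_nhds (hU v hvn t ht))
    · refine le_trans ?_ (hg₀ _ (hU v hvn t ht)).2
      refine ((iteratedFDeriv ℝ 3 g₀ (x + t • v)).le_opNorm _).trans ?_
      refine mul_le_of_le_one_right (norm_nonneg _) ?_
      exact Finset.prod_le_one (fun _ _ => norm_nonneg _) fun _ _ => hvn
    · refine abs_multilinear_diag_le _ (fun r => ?_) hvn
      convert! hM _ (hU v hvn t ht) (r 0) (r 1) (r 2) using 3
      ext i
      fin_cases i <;> rfl
  -- The second derivative along `v` is even in `v`, so the sign of the direction is immaterial.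
  rcases hv with rfl | rfl
  · exact key
  · simpa [iteratedFDeriv_two_apply] using key

/-! ### The Hessian estimates -/

theorem lemma2p8 {d κ J : ℕ} (hJ : 1 ≤ J)
    (D Ω : Set (Param d)) (hD : IsOpen D) (hΩ : IsCompact Ω) (hΩD : Ω ⊆ D)
    (f : Fin κ → Param d → ℝ) (hf : ∀ l, AnalyticOnNhd ℝ (f l) D)
    (A : Fin κ → Ell2 →L[ℂ] Ell2)
    (hAc : ∀ l, IsCompactOperator (A l)) (hAs : ∀ l, IsSelfAdjoint (A l))
    (hpos : ∀ ω ∈ Ω, (J : Cardinal) ≤ eigCount (opFun f A ω) (Set.Ioi 0))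
    (ω : ℕ → Param d) (m : ℕ → ℕ)
    (V : (k : ℕ) → EuclideanSpace ℂ (Fin (m k)) →ₗᵢ[ℂ] Ell2)
    (hrun : IsExtGreedyRun f A D Ω J ω m V ∨ (d = 1 ∧ IsGreedyRun f A Ω J ω m V))
    (ωs : Param d) (hlim : Tendsto ω atTop (𝓝 ωs)) (hint : ωs ∈ interior Ω)
    (hsimple : eigCount (opFun f A ωs) {lam f A J ωs} = 1)
    (hthird : UniformlyBoundedThirdDerivs (fun k => redLam f A J (V k)) ωs) :
    (∃ C : ℝ, 0 < C ∧ ∀ᶠ k in atTop,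
      ContDiffAt ℝ 2 (lam f A J) (ω k) ∧ ContDiffAt ℝ 2 (redLam f A J (V k)) (ω k) ∧
      (0 < stepLen ω k →
        (∀ p q : Fin d, |hessian (lam f A J) (ω k) p q
            - hessian (redLam f A J (V k)) (ω k) p q| ≤ C * stepLen ω k) ∧
        specNorm (hessian (lam f A J) (ω k) - hessian (redLam f A J (V k)) (ω k))
          ≤ d * C * stepLen ω k)) ∧
    (IsUnit (hessian (lam f A J) ωs) →
      ∃ C' : ℝ, 0 < C' ∧ ∀ᶠ k in atTop,
        IsUnit (hessian (lam f A J) (ω k)) ∧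
        (0 < stepLen ω k →
          IsUnit (hessian (redLam f A J (V k)) (ω k)) ∧
          specNorm ((hessian (lam f A J) (ω k))⁻¹ - (hessian (redLam f A J (V k)) (ω k))⁻¹)
            ≤ C' * stepLen ω k)) := by
  have hlam : ContDiffAt ℝ 3 (lam f A J) ωs :=
    contDiffAt_lam (by norm_num) hJ hAc hAs hpos
      (fun l => (hf l ωs (hΩD (interior_subset hint))).contDiffAt) hint hsimple
  obtain ⟨K, hK⟩ := exists_eventually_contDiffAt_three_and_norm_le hlam
  obtain ⟨c, r, M, k₀, hc, hk₀⟩ := hthird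
  -- One ball around `ωs` lies in `Ω` and in the ball of uniform third derivative bounds, and
  -- carries the C³ bound for `λ_J`. Keeping both `ω k` within `ρ / 2` of `ωs` and the step below `ρ
  -- / 2` confines all segments used to this ball.
  obtain ⟨ρ, hρ, hball⟩ := Metric.eventually_nhds_iff_ball.1
    (hK.and ((eventually_mem_set.2 (mem_interior_iff_mem_nhds.1 hint)).and
      (Metric.isOpen_ball.eventually_mem hc)))
  have hstep : Tendsto (stepLen ω) atTop (𝓝 0) := by
    have h1 := (hlim.sub (hlim.comp (tendsto_sub_atTop_nat 1))).norm
    simpa [stepLen] using! h1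
  -- The `2` comes from polarization and `d ^ 3` from expanding the third derivative in coordinates;
  -- absolute values and `+ 1` ensure positivity.
  set C : ℝ := 2 * (|K| + d ^ 3 * |M|) + 1 with hC
  have hCpos : 0 < C := by positivity
  have hnear : ∀ᶠ k in atTop, ω k ∈ Metric.ball ωs (ρ / 2) ∧ stepLen ω k < ρ / 2 ∧ k₀ ≤ k ∧ 2 ≤ k :=
    (hlim.eventually (Metric.ball_mem_nhds _ (by positivity))).and
      ((hstep.eventually (eventually_lt_nhds (by positivity))).and
        ((eventually_ge_atTop k₀).and (eventually_ge_atTop 2)))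
  have hmain : ∀ᶠ k in atTop,
      ContDiffAt ℝ 2 (lam f A J) (ω k) ∧ ContDiffAt ℝ 2 (redLam f A J (V k)) (ω k) ∧
      (0 < stepLen ω k →
        (∀ p q : Fin d, |hessian (lam f A J) (ω k) p q
            - hessian (redLam f A J (V k)) (ω k) p q| ≤ C * stepLen ω k) ∧
        specNorm (hessian (lam f A J) (ω k) - hessian (redLam f A J (V k)) (ω k))
          ≤ d * C * stepLen ω k) := by
    filter_upwards [hnear] with k hk
    obtain ⟨hωk, hhk, hkk₀, hk2⟩ := hk
    have hωk' : ω k ∈ Metric.ball ωs ρ := Metric.ball_subset_ball (by linarith) hωk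
    have hdiff : ∀ i < 3, DifferentiableOn ℝ (iteratedFDeriv ℝ i (redLam f A J (V k)))
        (Metric.ball ωs ρ) := fun i hi =>
      ((hk₀ k hkk₀).1 i hi).mono fun y hy => (hball y hy).2.2
    refine ⟨(hball _ hωk').1.1.of_le (by norm_num),
      contDiffAt_two_of_differentiableOn Metric.isOpen_ball hdiff hωk', fun hpos_step => ?_⟩
    have hI : InterpolatesAlong (redLam f A J (V k)) (lam f A J) Ω (ω k) (stepLen ω k) := by
      rcases hrun with h | ⟨hd, h⟩
      · exact h.interpolatesAlong hJ hAc hAs hpos hk2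
      · exact h.interpolatesAlong hd hJ hAc hAs hpos hk2 hpos_step
    have hent : ∀ p q : Fin d, |hessian (lam f A J) (ω k) p q
        - hessian (redLam f A J (V k)) (ω k) p q| ≤ C * stepLen ω k := by
      intro p q
      have h1 := hI.abs_hessian_sub_le (U := Metric.ball ωs ρ) (K := |K|) (M := |M|) hpos_step
        (fun v hv t ht => by
          have h2 : ‖t • v‖ < ρ / 2 := by
            rw [norm_smul, Real.norm_of_nonneg ht.1]
            nlinarith [ht.2, ht.1, norm_nonneg v]
          have h3 := mem_ball_iff_norm.1 hωk
          rw [mem_ball_iff_norm, add_sub_right_comm]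
          exact (norm_add_le _ _).trans_lt (by linarith))
        Metric.isOpen_ball (fun y hy => (hball y hy).2.1)
        (fun y hy => redLam_le_lam hJ hAc hAs (V k) (hpos y (hball y hy).2.1))
        (fun y hy => ⟨(hball y hy).1.1, (hball y hy).1.2.trans (le_abs_self K)⟩) hdiff
        (fun y hy p q l => ((hk₀ k hkk₀).2 y (hball y hy).2.2 p q l).trans (le_abs_self M)) p q
      rw [hC]
      linarith
    refine ⟨hent, ?_⟩
    rw [mul_assoc]
    exact specNorm_le (by positivity) hent
  refine ⟨⟨C, hCpos, hmain⟩, fun hunit => ?_⟩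
  obtain ⟨L, hL, ε, hε, U, hU, hLip⟩ := exists_specNorm_inv_sub_le hunit
  have hhess := (tendsto_hessian (hlam.of_le (by norm_num))).comp hlim
  have hsmall : ∀ᶠ k in atTop, d * C * stepLen ω k < ε := by
    have h1 : Tendsto (fun k => d * C * stepLen ω k) atTop (𝓝 (d * C * 0)) := hstep.const_mul _
    rw [mul_zero] at h1
    exact h1.eventually (eventually_lt_nhds hε)
  refine ⟨L * (d * C) + 1, by positivity, ?_⟩
  filter_upwards [hmain, hhess.eventually hU, hsmall] with k hk hkU hkε
  -- Taking `B = A` in the Lipschitz statement gives invertibility of the full Hessian even when the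
  -- step length is zero.
  refine ⟨(hLip _ hkU _ (by rw [sub_self]; simpa [specNorm] using hε)).1, fun hpos_step => ?_⟩
  have hn := (hk.2.2 hpos_step).2
  obtain ⟨-, hB, hinv⟩ := hLip _ hkU _ (hn.trans_lt hkε)
  refine ⟨hB, hinv.trans ?_⟩
  calc _ ≤ L * (d * C * stepLen ω k) := mul_le_mul_of_nonneg_left hn hL.le
    _ ≤ (L * (d * C) + 1) * stepLen ω k := by linarith
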